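/- Let $\ell\ge 2$ and let $\Phi$ be a (reduced, crystallographic) root system of type $B_\ell$ spanning a Euclidean space $E$, with simple roots $\alpha_1,\dots,\alpha_\ell$ in the standard numbering ($\alpha_\ell$ is the short simple root, at the end of the chain, and $\alpha_1$ is at the other end), highest root $\tilde\alpha$ and Weyl group $W$. Let $Z=\{x\in E : (\alpha,x)\in\mathbb Z \text{ for all } \alpha\in\Phi\}$ be the coweight lattice. For a positive integer $q$ the group $W$ acts on $$M(\Phi;q)=\{\,x+qZ\in Z/qZ : (\beta,x)\not\equiv 0 \ (\mathrm{mod}\ q)\text{ for all }\beta\in\Phi\,\},$$ and $\chi_{\Phi,q}(w)$ denotes the permutation character of this action, i.e. the number of points of $M(\Phi;q)$ fixed by $w$. Let $A_\circ=\{x\in E : (\alpha_i,x)>0 \text{ for all } i,\ (\tilde\alpha,x)<1\}$ be the fundamental alcove and $P^\diamond=\{x\in E : 0<(\alpha_i,x)\le 1 \text{ for all } i\}$. Then $W$ acts on $P^\diamond$ by sending $x$ to the unique point of $P^\diamond$ congruent to $w(x)$ modulo $Z$; let $W_{A_\circ}\subseteq W$ be the stabilizer of the set $A_\circ$ under this action.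 Let $\omega_1=w_1w_0$, where $w_0$ is the longest element of $W$ and $w_1$ is the longest element of the subgroup generated by the reflections in $\alpha_2,\dots,\alpha_\ell$. Then $W_{A_\circ}=\{1,\omega_1\}$, and for every positive integer $q$ and every $\omega\in W_{A_\circ}$ $$\chi_{\Phi,q}(\omega)=\begin{cases} (q-1)(q-3)\cdots(q-(2\ell-1)) & \text{if } \omega=1 \text{ and } q \text{ is odd},\\ (q-2)(q-4)\cdots(q-2(\ell-1))\,(q-\ell) & \text{if } \omega=1 \text{ and } q \text{ is even},\\ 0 & \text{if } \omega=\omega_1 \text{ and } q \text{ is odd},\\ (q-2)(q-4)\cdots(q-2(\ell-1)) & \text{if } \omega=\omega_1 \text{ and } q \text{ is even}. \end{cases}$$ -/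

import Mathlib

open scoped RealInnerProductSpace

namespace CoxeterCharacter

/-! ### Longest elements -/

section Length

variable {G : Type*} [Group G]

/-- The word length of `w` with respect to `S`: the least length of an expression of `w` as a
product of elements of `S`. It is only used for sets `S` of involutions and for `w` in the group
generated by `S`, where such expressions exist. -/
noncomputable def wordLength (S : Set G) (w : G) : ℕ :=
  sInf {n | ∃ l : List G, (∀ s ∈ l, s ∈ S) ∧ l.prod = w ∧ l.length = n}

/-- `w` is an element of maximal word length in the subgroup generated by `S`. -/
def IsLongest (S : Set G) (w : G) : Prop :=
  w ∈ Subgroup.closure S ∧ ∀ v ∈ Subgroup.closure S, wordLength S v ≤ wordLength S w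

theorem exists_isLongest [Finite G] (S : Set G) : ∃ w, IsLongest S w := by
  obtain ⟨w, hw, h⟩ := Set.exists_max_image (Subgroup.closure S : Set G) (wordLength S)
    (Set.toFinite _) ⟨1, one_mem _⟩
  exact ⟨w, hw, h⟩

/-- The longest element of the subgroup generated by `S` (it is unique when `S` is a set of simple
reflections of a finite reflection group). -/
noncomputable def longestElement [Finite G] (S : Set G) : G :=
  (exists_isLongest S).choose

end Length

variable {ι E N : Type*} [NormedAddCommGroup E] [InnerProductSpace ℝ E]
  [AddCommGroup N] [Module ℝ N]

/-- The root pairing `P` is a root system in the Euclidean space `E` (with set of roots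
`Set.range P.root`): the coroot of `α`, seen as a linear form on `E`, is
`x ↦ 2 (α, x) / (α, α)`, so that the reflection in `α` is the orthogonal reflection. -/
class IsEuclidean (P : RootPairing ι ℝ E N) : Prop where
  toLinearMap_coroot (i : ι) (x : E) :
    P.toLinearMap x (P.coroot i) = 2 * ⟪P.root i, x⟫ / ⟪P.root i, P.root i⟫

section Basic

variable (P : RootPairing ι ℝ E N)

/-- The Weyl group acts on `E` by isometries. -/
theorem inner_smul_smul [IsEuclidean P] (w : P.weylGroup) (x y : E) :
    ⟪w • x, w • y⟫ = ⟪x, y⟫ := by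
  obtain ⟨g, hg⟩ := w
  change ⟪g • x, g • y⟫ = ⟪x, y⟫
  induction hg using RootPairing.weylGroup.induction generalizing x y with
  | mem i =>
    have h0 : ⟪P.root i, P.root i⟫ ≠ 0 := inner_self_ne_zero.mpr (P.ne_zero i)
    simp only [RootPairing.Equiv.reflection_smul, RootPairing.reflection_apply,
      RootPairing.coroot', LinearMap.flip_apply, IsEuclidean.toLinearMap_coroot,
      inner_sub_left, inner_sub_right, real_inner_smul_left, real_inner_smul_right]
    rw [real_inner_comm (P.root i) x]
    field_simp
    ring
  | one => simp
  | mul g₁ g₂ h₁ h₂ ih₁ ih₂ => rw [mul_smul, mul_smul, ih₁, ih₂]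

instance weylGroup_finite [Finite ι] [P.IsRootSystem] : Finite P.weylGroup := by
  refine Finite.of_injective (fun w : P.weylGroup => RootPairing.Equiv.indexHom P w) ?_
  intro v w h
  apply Subtype.ext
  apply RootPairing.Equiv.weightHom_injective P
  have hroot (i : ι) : v • P.root i = w • P.root i := by
    rw [P.weylGroup_apply_root, P.weylGroup_apply_root]
    exact congrArg (fun f : ι ≃ ι => P.root (f i)) h
  apply LinearEquiv.toLinearMap_injective
  refine LinearMap.ext_on_range (RootPairing.IsRootSystem.span_root_eq_top (P := P)) ?_
  exact hroot

/-- The coweight lattice `Z`: all `x` with `(α, x) ∈ ℤ` for every root `α`. -/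
def coweightLattice : AddSubgroup E where
  carrier := {x | ∀ i, ∃ n : ℤ, ⟪P.root i, x⟫ = n}
  zero_mem' i := ⟨0, by simp⟩
  add_mem' {x y} hx hy i := by
    obtain ⟨m, hm⟩ := hx i
    obtain ⟨n, hn⟩ := hy i
    exact ⟨m + n, by rw [inner_add_right, hm, hn]; push_cast; rfl⟩
  neg_mem' {x} hx i := by
    obtain ⟨m, hm⟩ := hx i
    exact ⟨-m, by rw [inner_neg_right, hm]; push_cast; rfl⟩

/-- The coweight lattice is stable under the Weyl group. -/
theorem smul_mem_coweightLattice [IsEuclidean P] (w : P.weylGroup) {x : E}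
    (hx : x ∈ coweightLattice P) : w • x ∈ coweightLattice P := by
  intro i
  obtain ⟨n, hn⟩ := hx (P.weylGroupToPerm w⁻¹ i)
  refine ⟨n, ?_⟩
  rw [← hn, ← P.weylGroup_apply_root, ← inner_smul_smul P w (w⁻¹ • P.root i), smul_inv_smul]

/-- The action of an element of the Weyl group on the coweight lattice. -/
noncomputable def latticeAction [IsEuclidean P] (w : P.weylGroup) :
    coweightLattice P →+ coweightLattice P where
  toFun x := ⟨w • (x : E), smul_mem_coweightLattice P w x.2⟩
  map_zero' := Subtype.ext (smul_zero w)
  map_add' x y := Subtype.ext (smul_add w (x : E) (y : E))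

/-- The sublattice `qZ` of `Z`. -/
def multiples (q : ℕ) : AddSubgroup (coweightLattice P) :=
  (nsmulAddMonoidHom q : coweightLattice P →+ coweightLattice P).range

/-- The action of `w` on `Z / qZ`, sending the class of `x` to the class of `w x`. -/
noncomputable def modAction [IsEuclidean P] (q : ℕ) (w : P.weylGroup) :
    coweightLattice P ⧸ multiples P q →+ coweightLattice P ⧸ multiples P q :=
  QuotientAddGroup.map _ _ (latticeAction P w) (by
    rintro _ ⟨y, rfl⟩
    exact ⟨latticeAction P w y, (map_nsmul (latticeAction P w) q y).symm⟩)

/-- The complement `M(Φ; q)` of the Coxeter arrangement in `Z / qZ`: the classes of those `x ∈ Z`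
with `(β, x) ≢ 0 (mod q)` for all roots `β` (`β` and `-β` impose the same condition, so this is the
same as asking it for the positive roots). -/
def complement (q : ℕ) : Set (coweightLattice P ⧸ multiples P q) :=
  {z | ∃ x : coweightLattice P, (x : coweightLattice P ⧸ multiples P q) = z ∧
    ∀ i, ¬ ∃ k : ℤ, ⟪P.root i, (x : E)⟫ = (q : ℝ) * k}

/-- The Weyl group preserves `M(Φ; q)`. -/
theorem modAction_mem_complement [IsEuclidean P] (q : ℕ) (w : P.weylGroup)
    {z : coweightLattice P ⧸ multiples P q} (hz : z ∈ complement P q) :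
    modAction P q w z ∈ complement P q := by
  obtain ⟨x, rfl, hx⟩ := hz
  refine ⟨latticeAction P w x, rfl, fun i ⟨k, hk⟩ => hx (P.weylGroupToPerm w⁻¹ i) ⟨k, ?_⟩⟩
  rw [← hk, ← P.weylGroup_apply_root, ← inner_smul_smul P w (w⁻¹ • P.root i), smul_inv_smul]
  rfl

/-- The value at `w` of the permutation character `χ_{Φ,q}` of the Weyl group on `M(Φ; q)`:
the number of points of `M(Φ; q)` fixed by `w`. -/
noncomputable def chi [IsEuclidean P] (q : ℕ) (w : P.weylGroup) : ℕ :=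
  {z ∈ complement P q | modAction P q w z = z}.ncard

end Basic

section Base

variable {P : RootPairing ι ℝ E N} (b : P.Base)

/-- `P.root k` is the highest root with respect to the base `b`: subtracting any root from it gives
a combination of simple roots with nonnegative integer coefficients. -/
def IsHighestRoot (k : ι) : Prop :=
  ∀ i, P.root k - P.root i ∈ AddSubmonoid.closure (P.root '' b.support)

/-- The fundamental alcove `A_∘` (an irreducible reduced root system has exactly one highest
root). -/
def fundamentalAlcove : Set E :=
  {x | (∀ i ∈ b.support, 0 < ⟪P.root i, x⟫) ∧ ∀ k, IsHighestRoot b k → ⟪P.root k, x⟫ < 1}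

/-- The half-open fundamental parallelepiped `P^⋄` of the coweight lattice. -/
def parallelepiped : Set E :=
  {x | ∀ i ∈ b.support, 0 < ⟪P.root i, x⟫ ∧ ⟪P.root i, x⟫ ≤ 1}

/-- The image of `C ⊆ P^⋄` under the action `ρ^⋄(w)` of `w` on `P^⋄`, where `ρ^⋄(w)(x)` is the
unique point of `P^⋄` that is congruent to `w x` modulo the coweight lattice. -/
def alcoveImage (w : P.weylGroup) (C : Set E) : Set E :=
  {y ∈ parallelepiped b | ∃ x ∈ C, y - w • x ∈ coweightLattice P}

/-- The stabilizer `W_{A_∘}` of the fundamental alcove under the action `ρ^⋄`. -/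
def alcoveStabilizer : Set P.weylGroup :=
  {w | alcoveImage b w (fundamentalAlcove b) = fundamentalAlcove b}

variable [Finite ι] [P.IsRootSystem]

/-- The longest element of the subgroup of the Weyl group generated by the reflections in the
roots indexed by `I`. It is used for sets of simple roots. -/
noncomputable def longest (P : RootPairing ι ℝ E N) [P.IsRootSystem] (I : Set ι) : P.weylGroup :=
  longestElement (RootPairing.weylGroup.ofIdx P '' I)

/-- The element `ω_j = w_j w_0` of the Weyl group, for a simple root `α_j`: here `w_0` is the
longest element of the Weyl group and `w_j` that of the parabolic subgroup obtained by
omitting `α_j`. -/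
noncomputable def omega (j : b.support) : P.weylGroup :=
  longest P ((b.support : Set ι) \ {(j : ι)}) * longest P (b.support : Set ι)

end Base

end CoxeterCharacter

/-! Put ε_k = α_k + ⋯ + α_n, with simple roots numbered from 0 to n = ℓ - 1. Each simple reflection
exchanges two neighbouring ε's or, for the last one, changes the sign of ε_n. Hence W acts on the
basis (ε_k) by signed permutations (`ActsBy`), and the roots are exactly ±ε_a and ±ε_a ± ε_c with a
≠ c. Orthogonality of the ε_k is never needed: a point x is described by its coordinates x_k = (ε_k,
x), and since W acts by isometries, w permutes these coordinates up to sign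
(`ActsBy.inner_eps_smul`). In these coordinates Z becomes ℤ^ℓ and the alcove is x_0 > x_1 > ⋯ > x_n
> 0, x_0 + x_1 < 1.

The longest elements are defined by word length. Counting inversions shows that a longest element of
a parabolic subgroup makes all its simple roots negative. For the parabolic of α_m, …, α_n, heights
then force it to be -1 on ε_m, …, ε_n and the identity on the other ε's. So w_0 = -1, and ω_1 is the
sign change of ε_0 alone (`IsTypeB.actsBy_omega`).

Modulo Z this sign change is x_0 ↦ 1 - x_0, which exchanges the walls x_0 = x_1 and x_0 + x_1 = 1
and so preserves the alcove. Conversely, testing a stabilizing element on an alcove point with all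
coordinates below 1/2 leaves only the sign of ε_0 free (`IsTypeB.eq_one_or_omega`).

Finally M(Φ; q) becomes the set of v in (ℤ/q)^ℓ with v_i ≠ 0 and v_i ≠ ±v_j, and ω_1 fixes v exactly
when v_0 = -v_0. For q odd, 0 is the only element equal to its negative; for q even there is also
q/2, which at most one coordinate can take. Choosing coordinates one at a time gives the products
(`card_strictlyRegular`, `card_regular_succ`). -/

namespace CoxeterCharacter

/-! ### Signed permutations of the vectors ε_k and the shape of the roots. -/

namespace TypeB

set_option linter.unusedSectionVars false

variable {ι E N : Type*} [NormedAddCommGroup E] [InnerProductSpace ℝ E]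
  [AddCommGroup N] [Module ℝ N] {P : RootPairing ι ℝ E N} {n : ℕ}

/-- The sums `ε_k = α_k + ⋯ + α_{n}` of the simple roots of a root system of type `B`. -/
noncomputable def eps {b : P.Base} (e : Fin (n + 1) ≃ b.support) (k : Fin (n + 1)) : E :=
  ∑ j ∈ Finset.Ici k, P.root (e j)

section eps

variable {b : P.Base} (e : Fin (n + 1) ≃ b.support)

theorem eps_last : eps e (Fin.last n) = P.root (e (Fin.last n)) := by
  have : Finset.Ici (Fin.last n) = {Fin.last n} := by
    ext j; simp [Fin.last_le_iff]
  simp [eps, this]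

theorem eps_castSucc (j : Fin n) :
    eps e j.castSucc = P.root (e j.castSucc) + eps e j.succ := by
  have : Finset.Ici j.castSucc = insert j.castSucc (Finset.Ici j.succ) := by
    ext i
    simp only [Finset.mem_Ici, Finset.mem_insert, Fin.le_def, Fin.ext_iff, Fin.val_castSucc,
      Fin.val_succ]
    omega
  rw [eps, this, Finset.sum_insert (by simp [Fin.le_def]), eps]

theorem root_castSucc (j : Fin n) :
    P.root (e j.castSucc) = eps e j.castSucc - eps e j.succ := by
  rw [eps_castSucc]; abel

variable [P.IsRootSystem]

/-- A linear form taking the value `1` at every simple root. -/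
noncomputable def htForm (b : P.Base) : E →ₗ[ℝ] ℝ := b.toWeightBasis.constr ℝ fun _ => 1

theorem htForm_root (i : b.support) : htForm b (P.root i) = 1 := by
  rw [htForm, ← b.toWeightBasis_apply, Module.Basis.constr_basis]

theorem htForm_eps (k : Fin (n + 1)) : htForm b (eps e k) = (n : ℝ) + 1 - (k : ℕ) := by
  induction k using Fin.reverseInduction with
  | last => rw [eps_last, htForm_root]; simp
  | cast j ih => rw [eps_castSucc, map_add, htForm_root, ih]; simp; ring

theorem span_eps : ⊤ ≤ Submodule.span ℝ (Set.range (eps e)) := by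
  rw [← (b.toWeightBasis).span_eq, Submodule.span_le]
  rintro _ ⟨i, rfl⟩
  obtain ⟨k, rfl⟩ := e.surjective i
  rw [b.toWeightBasis_apply]
  induction k using Fin.lastCases with
  | last => rw [← eps_last]; exact Submodule.subset_span ⟨_, rfl⟩
  | cast j =>
    rw [root_castSucc]
    exact sub_mem (Submodule.subset_span ⟨_, rfl⟩) (Submodule.subset_span ⟨_, rfl⟩)

theorem linearIndependent_eps : LinearIndependent ℝ (eps e) := by
  classical
  refine linearIndependent_of_top_le_span_of_card_eq_finrank (span_eps e) ?_
  rw [Module.finrank_eq_card_basis b.toWeightBasis, ← Fintype.card_congr e]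

/-- The vectors `ε_k` as a basis. -/
noncomputable def epsBasis : Module.Basis (Fin (n + 1)) ℝ E :=
  Module.Basis.mk (linearIndependent_eps e) (span_eps e)

@[simp] theorem epsBasis_apply (k : Fin (n + 1)) : epsBasis e k = eps e k := by
  simp [epsBasis]

end eps

variable [P.IsRootSystem] [P.IsCrystallographic] {b : P.Base} {e : Fin (n + 1) ≃ b.support}

/-- The Cartan matrix with respect to the numbering `e` of the simple roots is of type `B`. -/
def IsTypeB (e : Fin (n + 1) ≃ b.support) : Prop :=
  ∀ i j, b.cartanMatrix (e i) (e j) = CartanMatrix.B (n + 1) i j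

theorem IsTypeB.pairing_eq (h : IsTypeB e) (i j : Fin (n + 1)) :
    P.pairing (e i) (e j) = (CartanMatrix.B (n + 1) i j : ℝ) := by
  rw [← h i j, ← b.algebraMap_cartanMatrixIn_apply ℤ]
  rfl

theorem IsTypeB.coroot'_eps_castSucc (h : IsTypeB e) (j : Fin n) (k : Fin (n + 1)) :
    P.coroot' (e j.castSucc) (eps e k) =
      (if k = j.castSucc then 1 else 0) - (if k = j.succ then 1 else 0) := by
  induction k using Fin.reverseInduction with
  | last =>
    rw [eps_last, P.root_coroot'_eq_pairing, h.pairing_eq]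
    simp only [CartanMatrix.B, Matrix.of_apply, Fin.ext_iff, Fin.val_last, Fin.val_castSucc,
      Fin.val_succ]
    have := j.2
    split_ifs <;> first | omega | norm_num
  | cast i ih =>
    rw [eps_castSucc, map_add, ih, P.root_coroot'_eq_pairing, h.pairing_eq]
    simp only [CartanMatrix.B, Matrix.of_apply, Fin.ext_iff, Fin.val_castSucc, Fin.val_succ]
    have := j.2
    split_ifs <;> first | omega | norm_num

theorem IsTypeB.coroot'_eps_last (h : IsTypeB e) (k : Fin (n + 1)) :
    P.coroot' (e (Fin.last n)) (eps e k) = if k = Fin.last n then 2 else 0 := by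
  induction k using Fin.reverseInduction with
  | last => simp [eps_last]
  | cast i ih =>
    rw [eps_castSucc, map_add, ih, P.root_coroot'_eq_pairing, h.pairing_eq]
    simp only [CartanMatrix.B, Matrix.of_apply, Fin.ext_iff, Fin.val_castSucc, Fin.val_succ,
      Fin.val_last]
    have := i.2
    split_ifs <;> first | omega | norm_num

theorem IsTypeB.reflection_castSucc_eps (h : IsTypeB e) (j : Fin n) (k : Fin (n + 1)) :
    P.reflection (e j.castSucc) (eps e k) = eps e (Equiv.swap j.castSucc j.succ k) := by
  have hne : j.castSucc ≠ j.succ := Fin.castSucc_lt_succ.ne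
  rw [P.reflection_apply, h.coroot'_eps_castSucc, root_castSucc]
  rcases eq_or_ne k j.castSucc with rfl | h1
  · simp [hne]
  rcases eq_or_ne k j.succ with rfl | h2
  · simp [hne.symm]
  · simp [h1, h2, Equiv.swap_apply_of_ne_of_ne]

theorem IsTypeB.reflection_last_eps (h : IsTypeB e) (k : Fin (n + 1)) :
    P.reflection (e (Fin.last n)) (eps e k) =
      if k = Fin.last n then -eps e k else eps e k := by
  rw [P.reflection_apply, h.coroot'_eps_last, ← eps_last]
  split_ifs with hk
  · subst hk; module
  · simp

/-- The sign `u` as a real number. -/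
noncomputable def sgn (u : ℤˣ) : ℝ := ((u : ℤ) : ℝ)

@[simp] theorem sgn_one : sgn 1 = 1 := by simp [sgn]
@[simp] theorem sgn_neg (u : ℤˣ) : sgn (-u) = -sgn u := by simp [sgn]
@[simp] theorem sgn_mul (u v : ℤˣ) : sgn (u * v) = sgn u * sgn v := by simp [sgn]

/-- `f` permutes the lines spanned by the `ε_k` by `σ`, with signs `s`. -/
def ActsBy (e : Fin (n + 1) ≃ b.support) (f : E → E) (σ : Equiv.Perm (Fin (n + 1)))
    (s : Fin (n + 1) → ℤˣ) : Prop :=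
  ∀ k, f (eps e k) = sgn (s k) • eps e (σ k)

theorem ActsBy.comp {f g : E → E} {σ τ s t} (hf : ActsBy e f σ s) (hg : ActsBy e g τ t)
    (hsmul : ∀ (c : ℝ) (x : E), f (c • x) = c • f x) :
    ActsBy e (f ∘ g) (σ * τ) (fun k => t k * s (τ k)) := by
  intro k
  simp [hg k, hf (τ k), smul_smul, hsmul]

theorem IsTypeB.actsBy_reflection_castSucc (h : IsTypeB e) (j : Fin n) :
    ActsBy e (P.reflection (e j.castSucc)) (Equiv.swap j.castSucc j.succ) 1 :=
  fun k => by simp [h.reflection_castSucc_eps]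

theorem IsTypeB.actsBy_reflection_last (h : IsTypeB e) :
    ActsBy e (P.reflection (e (Fin.last n))) 1 (fun k => if k = Fin.last n then -1 else 1) := by
  intro k
  rw [h.reflection_last_eps]
  split_ifs with hk <;> simp [hk]

theorem IsTypeB.exists_actsBy_reflection_simple (h : IsTypeB e) (k : Fin (n + 1)) :
    ∃ σ s, ActsBy e (P.reflection (e k)) σ s := by
  induction k using Fin.lastCases with
  | last => exact ⟨_, _, h.actsBy_reflection_last⟩
  | cast j => exact ⟨_, _, h.actsBy_reflection_castSucc j⟩

/-- Every root is reached from simple roots by simple reflections and negation, and the reflection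
in s_j(α_i) is s_j s_i s_j; signed permutations are closed under composition. -/
theorem IsTypeB.exists_actsBy_reflection [Finite ι] [P.IsReduced] (h : IsTypeB e) (i : ι) :
    ∃ σ s, ActsBy e (P.reflection i) σ s := by
  have conj (i j : ι) (hi : ∃ σ s, ActsBy e (P.reflection i) σ s)
      (hj : ∃ σ s, ActsBy e (P.reflection j) σ s) :
      ∃ σ s, ActsBy e (P.reflection (P.reflectionPerm j i)) σ s := by
    obtain ⟨σ, s, hi⟩ := hi
    obtain ⟨τ, t, hj⟩ := hj
    have key := hj.comp (hi.comp hj (map_smul (P.reflection i))) (map_smul (P.reflection j))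
    refine ⟨_, _, fun k => (?_ : _ = _).trans (key k)⟩
    rw [P.reflection_reflectionPerm]
    rfl
  refine b.induction_reflect i (p := fun i => ∃ σ s, ActsBy e (P.reflection i) σ s)
    (fun i hi => conj i i hi hi) ?_ (fun i j hi hj => conj i j hi ?_)
  · intro i hi
    obtain ⟨k, hk⟩ := e.surjective ⟨i, hi⟩
    simpa [hk] using h.exists_actsBy_reflection_simple k
  · obtain ⟨k, hk⟩ := e.surjective ⟨j, hj⟩
    simpa [hk] using h.exists_actsBy_reflection_simple k

theorem IsTypeB.exists_actsBy [Finite ι] [P.IsReduced] (h : IsTypeB e) (w : P.weylGroup) :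
    ∃ σ s, ActsBy e (w • ·) σ s := by
  obtain ⟨g, hg⟩ := w
  change ∃ σ s, ActsBy e (g • ·) σ s
  induction hg using RootPairing.weylGroup.induction with
  | mem i => exact h.exists_actsBy_reflection i
  | one => exact ⟨1, 1, fun k => by simp⟩
  | mul g₁ g₂ h₁ h₂ ih₁ ih₂ =>
    obtain ⟨σ, s, h1⟩ := ih₁
    obtain ⟨τ, t, h2⟩ := ih₂
    refine ⟨_, _, fun k => ((?_ : _ = _)).trans
      (h1.comp h2 (fun c x => smul_comm g₁ c x) k)⟩
    exact mul_smul g₁ g₂ _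

theorem weylGroup_ext {v w : P.weylGroup} (hvw : ∀ k, v • eps e k = w • eps e k) : v = w := by
  apply Subtype.ext
  apply RootPairing.Equiv.weightHom_injective P
  apply LinearEquiv.toLinearMap_injective
  refine (epsBasis e).ext fun k => ?_
  rw [epsBasis_apply]
  exact hvw k

/-- The vectors `±ε_a` and `±ε_a ± ε_c` with `a ≠ c`. -/
inductive IsShape (e : Fin (n + 1) ≃ b.support) : E → Prop
  | short (u : ℤˣ) (a : Fin (n + 1)) : IsShape e (sgn u • eps e a)
  | long (u v : ℤˣ) (a c : Fin (n + 1)) (hac : a ≠ c) :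
      IsShape e (sgn u • eps e a + sgn v • eps e c)

theorem IsShape.map {f : E →ₗ[ℝ] E} {σ s} (hf : ActsBy e f σ s) {x : E} (hx : IsShape e x) :
    IsShape e (f x) := by
  induction hx with
  | short u a =>
    rw [map_smul, hf a, smul_smul, ← sgn_mul]
    exact .short _ _
  | long u v a c hac =>
    rw [map_add, map_smul, map_smul, hf a, hf c, smul_smul, smul_smul, ← sgn_mul, ← sgn_mul]
    exact .long _ _ _ _ (σ.injective.ne hac)

theorem isShape_root_simple (k : Fin (n + 1)) : IsShape e (P.root (e k)) := by
  induction k using Fin.lastCases with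
  | last => simpa [eps_last] using IsShape.short (e := e) 1 (Fin.last n)
  | cast j =>
    rw [root_castSucc]
    simpa [sub_eq_add_neg] using
      IsShape.long (e := e) 1 (-1) j.castSucc j.succ Fin.castSucc_lt_succ.ne

theorem IsTypeB.isShape_root [Finite ι] [P.IsReduced] (h : IsTypeB e) (i : ι) :
    IsShape e (P.root i) := by
  have step (i j : ι) (hi : IsShape e (P.root i)) :
      IsShape e (P.root (P.reflectionPerm j i)) := by
    obtain ⟨σ, s, hj⟩ := h.exists_actsBy_reflection j
    rw [P.root_reflectionPerm]
    exact hi.map (f := (P.reflection j).toLinearMap) hj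
  refine b.induction_reflect i (p := fun i => IsShape e (P.root i))
    (fun i hi => step i i hi) ?_ (fun i j hi _ => step i j hi)
  intro i hi
  obtain ⟨k, hk⟩ := e.surjective ⟨i, hi⟩
  simpa [hk] using isShape_root_simple (e := e) k

end TypeB

/-! ### Word length, inversions and longest elements. -/

section Inversions

set_option linter.unusedSectionVars false

open RootPairing

variable {ι E N : Type*} [NormedAddCommGroup E] [InnerProductSpace ℝ E]
  [AddCommGroup N] [Module ℝ N] {P : RootPairing ι ℝ E N} [Finite ι] [P.IsRootSystem]
  [P.IsCrystallographic] [P.IsReduced] {b : P.Base}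

/-- The linear form with value 1 at each simple root restricts to the height, so positivity can be
tested on coordinates. -/
theorem isPos_iff_htForm (i : ι) : b.IsPos i ↔ 0 < TypeB.htForm b (P.root i) := by
  obtain ⟨f, -, -, hf⟩ := b.exists_root_eq_sum_int i
  have : TypeB.htForm b (P.root i) = b.height i := by
    rw [Base.height_eq_sum hf, hf, map_sum]
    push_cast
    refine Finset.sum_congr rfl fun j hj => ?_
    rw [map_zsmul, TypeB.htForm_root ⟨j, hj⟩]
    simp
  rw [this, Int.cast_pos, Base.isPos_iff]

theorem htForm_root_ne_zero (i : ι) : TypeB.htForm b (P.root i) ≠ 0 := by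
  intro h
  have h1 := (isPos_iff_htForm (b := b) i).not.2 (by simp [h])
  -- `P.reflectionPerm i i` is the index of the negative of root `i`.
  have h2 := (isPos_iff_htForm (b := b) (P.reflectionPerm i i)).not.2 (by simp [h])
  rcases Base.IsPos.or_neg b i with h3 | h3
  · exact h1 h3
  · exact h2 h3

theorem not_isPos_iff_htForm (i : ι) : ¬ b.IsPos i ↔ TypeB.htForm b (P.root i) < 0 := by
  rw [isPos_iff_htForm, not_lt]
  exact ⟨fun h => lt_of_le_of_ne h (htForm_root_ne_zero i), le_of_lt⟩

theorem weylGroupToPerm_mul_ofIdx (w : P.weylGroup) (j i : ι) :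
    P.weylGroupToPerm (w * weylGroup.ofIdx P j) i =
      P.weylGroupToPerm w (P.reflectionPerm j i) := by
  rw [map_mul]; rfl

theorem ofIdx_mul_self (j : ι) : weylGroup.ofIdx P j * weylGroup.ofIdx P j = 1 := by
  apply Subtype.ext
  change Equiv.reflection P j * Equiv.reflection P j = 1
  rw [mul_eq_one_iff_inv_eq, Equiv.reflection_inv]

theorem ofIdx_inv (j : ι) : (weylGroup.ofIdx P j)⁻¹ = weylGroup.ofIdx P j :=
  inv_eq_of_mul_eq_one_left (ofIdx_mul_self j)

theorem isPos_perm_reflectionPerm_self (w : P.weylGroup) (j : ι) :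
    b.IsPos (P.weylGroupToPerm w (P.reflectionPerm j j)) ↔ ¬ b.IsPos (P.weylGroupToPerm w j) := by
  rw [not_isPos_iff_htForm, isPos_iff_htForm, ← P.weylGroup_apply_root, ← P.weylGroup_apply_root,
    P.root_reflectionPerm, P.reflection_apply_self, smul_neg, map_neg]
  simp

variable (b) in
/-- The positive roots that `w` makes negative. -/
def inversions (w : P.weylGroup) : Set ι :=
  {i | b.IsPos i ∧ ¬ b.IsPos (P.weylGroupToPerm w i)}

theorem inversions_one : inversions b (1 : P.weylGroup) = ∅ := by
  ext i; simp [inversions]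

/-- A simple reflection s_j permutes the positive roots other than α_j, so passing from w to w s_j
transports the old inversions and creates just the new one α_j. -/
theorem inversions_mul_ofIdx {w : P.weylGroup} {j : ι} (hj : j ∈ b.support)
    (hw : b.IsPos (P.weylGroupToPerm w j)) :
    inversions b (w * weylGroup.ofIdx P j) =
      insert j (P.reflectionPerm j '' inversions b w) := by
  ext i
  simp only [inversions, Set.mem_ofPred_eq, weylGroupToPerm_mul_ofIdx, Set.mem_insert_iff,
    Set.mem_image]
  constructor
  · rintro ⟨h1, h2⟩
    rcases eq_or_ne i j with rfl | hij
    · exact .inl rfl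
    · exact .inr ⟨P.reflectionPerm j i, ⟨h1.reflectionPerm hj hij, h2⟩, by simp⟩
  · rintro (rfl | ⟨k, ⟨h1, h2⟩, rfl⟩)
    · refine ⟨Base.isPos_of_mem_support hj, ?_⟩
      rwa [isPos_perm_reflectionPerm_self, not_not]
    · have hkj : k ≠ j := by rintro rfl; exact h2 hw
      exact ⟨h1.reflectionPerm hj hkj, by simpa using h2⟩

theorem ncard_inversions_mul_ofIdx {w : P.weylGroup} {j : ι} (hj : j ∈ b.support)
    (hw : b.IsPos (P.weylGroupToPerm w j)) :
    (inversions b (w * weylGroup.ofIdx P j)).ncard = (inversions b w).ncard + 1 := by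
  rw [inversions_mul_ofIdx hj hw, Set.ncard_insert_of_notMem,
    Set.ncard_image_of_injective _ (P.reflectionPerm j).injective]
  rintro ⟨k, ⟨h1, -⟩, h2⟩
  have hk : k = P.reflectionPerm j j := by simpa using congrArg (P.reflectionPerm j) h2
  have := isPos_perm_reflectionPerm_self (b := b) (1 : P.weylGroup) j
  simp only [map_one, Equiv.Perm.coe_one, id_eq] at this
  exact this.1 (hk ▸ h1) (Base.isPos_of_mem_support hj)

theorem ncard_inversions_of_not_isPos {w : P.weylGroup} {j : ι} (hj : j ∈ b.support)
    (hw : ¬ b.IsPos (P.weylGroupToPerm w j)) :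
    (inversions b w).ncard = (inversions b (w * weylGroup.ofIdx P j)).ncard + 1 := by
  rw [← ncard_inversions_mul_ofIdx hj, mul_assoc, ofIdx_mul_self, mul_one]
  rwa [weylGroupToPerm_mul_ofIdx, isPos_perm_reflectionPerm_self]

variable {J : Set ι}

theorem exists_word {w : P.weylGroup} (hw : w ∈ Subgroup.closure (weylGroup.ofIdx P '' J)) :
    ∃ l : List P.weylGroup, (∀ s ∈ l, s ∈ weylGroup.ofIdx P '' J) ∧ l.prod = w ∧
      l.length = wordLength (weylGroup.ofIdx P '' J) w := by
  obtain ⟨l, h1, h2⟩ : ∃ l : List P.weylGroup,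
      (∀ s ∈ l, s ∈ weylGroup.ofIdx P '' J) ∧ l.prod = w := by
    induction hw using Subgroup.closure_induction with
    | mem s hs => exact ⟨[s], by simpa using hs, by simp⟩
    | one => exact ⟨[], by simp, rfl⟩
    | mul v w _ _ hv hw =>
      obtain ⟨l, h1, rfl⟩ := hv
      obtain ⟨l', h2, rfl⟩ := hw
      refine ⟨l ++ l', fun s hs => ?_, List.prod_append⟩
      exact (List.mem_append.1 hs).elim (h1 s) (h2 s)
    | inv w _ hw =>
      obtain ⟨l, h1, rfl⟩ := hw
      -- The generators are involutions, so the inverted word is again a word in them.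
      refine ⟨(l.map (·⁻¹)).reverse, fun s hs => ?_, by rw [List.prod_inv_reverse]⟩
      obtain ⟨t, ht, rfl⟩ := List.mem_map.1 (List.mem_reverse.1 hs)
      obtain ⟨j, hj, rfl⟩ := h1 t ht
      exact ⟨j, hj, (ofIdx_inv j).symm⟩
  exact Nat.sInf_mem (s := {n | ∃ l : List P.weylGroup,
    (∀ s ∈ l, s ∈ weylGroup.ofIdx P '' J) ∧ l.prod = w ∧ l.length = n}) ⟨_, l, h1, h2, rfl⟩

theorem wordLength_le {S : Set P.weylGroup} {l : List P.weylGroup} (hl : ∀ s ∈ l, s ∈ S) :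
    wordLength S l.prod ≤ l.length := Nat.sInf_le ⟨l, hl, rfl, rfl⟩

theorem ncard_inversions_prod_le (hJ : J ⊆ b.support) (l : List P.weylGroup)
    (hl : ∀ s ∈ l, s ∈ weylGroup.ofIdx P '' J) : (inversions b l.prod).ncard ≤ l.length := by
  induction l using List.reverseRecOn with
  | nil => simp [inversions_one]
  | append_singleton l s ih =>
    have ih' := ih fun t ht => hl t (by simp [ht])
    obtain ⟨j, hj, rfl⟩ := hl s (by simp)
    rw [List.prod_append, List.prod_singleton, List.length_append, List.length_singleton]
    by_cases hw : b.IsPos (P.weylGroupToPerm l.prod j)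
    · rw [ncard_inversions_mul_ofIdx (hJ hj) hw]; omega
    · have := ncard_inversions_of_not_isPos (hJ hj) hw; omega

/-- While some simple root of `J` is sent to a negative root, multiplying by its reflection removes
one inversion; when none is, `hone` says that the element is 1. With `ncard_inversions_prod_le` this
identifies length and number of inversions. -/
theorem wordLength_le_ncard_inversions (hJ : J ⊆ b.support)
    (hone : ∀ v ∈ Subgroup.closure (weylGroup.ofIdx P '' J),
      (∀ j ∈ J, b.IsPos (P.weylGroupToPerm v j)) → v = 1) {w : P.weylGroup}
    (hw : w ∈ Subgroup.closure (weylGroup.ofIdx P '' J)) :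
    wordLength (weylGroup.ofIdx P '' J) w ≤ (inversions b w).ncard := by
  induction hN : (inversions b w).ncard using Nat.strong_induction_on generalizing w with
  | _ m ih =>
    by_cases h : ∀ j ∈ J, b.IsPos (P.weylGroupToPerm w j)
    · rw [hone w hw h]
      exact (wordLength_le (l := []) (by simp)).trans (by simp)
    · push Not at h
      obtain ⟨j, hj, hneg⟩ := h
      have hcard := ncard_inversions_of_not_isPos (hJ hj) hneg
      have hmem : w * weylGroup.ofIdx P j ∈ Subgroup.closure (weylGroup.ofIdx P '' J) :=
        mul_mem hw (Subgroup.subset_closure ⟨j, hj, rfl⟩)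
      have hle := ih _ (by omega) hmem rfl
      obtain ⟨l, hl, hprod, hlen⟩ := exists_word hmem
      have := wordLength_le (S := weylGroup.ofIdx P '' J) (l := l ++ [weylGroup.ofIdx P j])
        (by
          intro s hs
          rw [List.mem_append, List.mem_singleton] at hs
          rcases hs with hs | rfl
          · exact hl s hs
          · exact ⟨j, hj, rfl⟩)
      rw [List.prod_append, List.prod_singleton, hprod, mul_assoc, ofIdx_mul_self, mul_one,
        List.length_append, List.length_singleton] at this
      omega

/-- A longest element of a standard parabolic subgroup makes its simple roots negative. -/
theorem IsLongest.not_isPos (hJ : J ⊆ b.support)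
    (hone : ∀ v ∈ Subgroup.closure (weylGroup.ofIdx P '' J),
      (∀ j ∈ J, b.IsPos (P.weylGroupToPerm v j)) → v = 1) {w : P.weylGroup}
    (hw : IsLongest (weylGroup.ofIdx P '' J) w) {j : ι} (hj : j ∈ J) :
    ¬ b.IsPos (P.weylGroupToPerm w j) := by
  intro hpos
  have hmem : w * weylGroup.ofIdx P j ∈ Subgroup.closure (weylGroup.ofIdx P '' J) :=
    mul_mem hw.1 (Subgroup.subset_closure ⟨j, hj, rfl⟩)
  have h1 := hw.2 _ hmem
  have h2 := wordLength_le_ncard_inversions hJ hone hw.1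
  have h3 := ncard_inversions_mul_ofIdx (hJ hj) hpos
  obtain ⟨l, hl, hprod, hlen⟩ := exists_word hmem
  have h4 := ncard_inversions_prod_le hJ l hl
  rw [hprod] at h4
  omega

end Inversions

theorem perm_eq_one_of_lt_succ {n : ℕ} {σ : Equiv.Perm (Fin (n + 1))}
    (h : ∀ j : Fin n, σ j.castSucc < σ j.succ) : σ = 1 := by
  have hσ : StrictMono σ := Fin.strictMono_iff_lt_succ.2 h
  ext k
  exact Fin.coe_orderIso_apply (hσ.orderIsoOfSurjective σ σ.surjective) k

/-! ### Longest elements of the tail parabolic subgroups and the element ω_1. -/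

namespace TypeB

set_option linter.unusedSectionVars false

open RootPairing

variable {ι E N : Type*} [NormedAddCommGroup E] [InnerProductSpace ℝ E]
  [AddCommGroup N] [Module ℝ N] {P : RootPairing ι ℝ E N} {n : ℕ} [Finite ι] [P.IsRootSystem]
  [P.IsCrystallographic] [P.IsReduced] {b : P.Base} {e : Fin (n + 1) ≃ b.support}

/-- The indices of the simple roots `α_m, α_{m+1}, …`. -/
def tail (e : Fin (n + 1) ≃ b.support) (m : ℕ) : Set ι :=
  (fun k => (e k : ι)) '' {k : Fin (n + 1) | m ≤ k}

theorem tail_subset (m : ℕ) : tail e m ⊆ b.support := by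
  rintro _ ⟨k, -, rfl⟩; exact (e k).2

theorem tail_zero : tail e 0 = b.support := by
  refine (tail_subset 0).antisymm fun i hi => ?_
  obtain ⟨k, hk⟩ := e.surjective ⟨i, hi⟩
  exact ⟨k, by simp, by simp [hk]⟩

theorem tail_one : tail e 1 = (b.support : Set ι) \ {(e 0 : ι)} := by
  ext i
  constructor
  · rintro ⟨k, hk, rfl⟩
    refine ⟨(e k).2, fun h => ?_⟩
    have : k = 0 := e.injective (Subtype.ext h)
    subst this
    simp at hk
  · rintro ⟨hi, h⟩
    obtain ⟨k, hk⟩ := e.surjective ⟨i, hi⟩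
    refine ⟨k, ?_, by simp [hk]⟩
    rw [Set.mem_ofPred_eq, Nat.one_le_iff_ne_zero]
    intro h0
    have : k = 0 := Fin.ext h0
    subst this
    exact h (by simp [hk])

/-- The standard parabolic subgroup generated by the reflections in `α_m, α_{m+1}, …`. -/
noncomputable def parabolic (e : Fin (n + 1) ≃ b.support) (m : ℕ) : Subgroup P.weylGroup :=
  Subgroup.closure (weylGroup.ofIdx P '' tail e m)

theorem ofIdx_smul (i : ι) (x : E) : weylGroup.ofIdx P i • x = P.reflection i x := rfl

theorem ActsBy.mul {v w : P.weylGroup} {σ τ s t} (hv : ActsBy e (v • ·) σ s)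
    (hw : ActsBy e (w • ·) τ t) :
    ActsBy e ((v * w) • ·) (σ * τ) (fun k => t k * s (τ k)) := by
  intro k
  exact (mul_smul v w _).trans (hv.comp hw (fun c x => smul_comm v.1 c x) k)

theorem IsTypeB.smul_eps_of_mem_parabolic (h : IsTypeB e) {m : ℕ} {w : P.weylGroup}
    (hw : w ∈ parabolic e m) {k : Fin (n + 1)} (hk : (k : ℕ) < m) : w • eps e k = eps e k := by
  induction hw using Subgroup.closure_induction with
  | mem s hs =>
    obtain ⟨_, ⟨j, hj, rfl⟩, rfl⟩ := hs
    rw [ofIdx_smul]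
    rw [Set.mem_ofPred_eq] at hj
    induction j using Fin.lastCases with
    | last =>
      rw [h.reflection_last_eps, if_neg]
      rintro rfl
      omega
    | cast j =>
      rw [h.reflection_castSucc_eps, Equiv.swap_apply_of_ne_of_ne] <;> rintro rfl <;>
        simp at * <;> omega
  | one => exact one_smul _ _
  | mul v w _ _ hv hw => rw [mul_smul, hw, hv]
  | inv w _ hw => rw [inv_smul_eq_iff, hw]

/-- The sign change of the single vector `ε_k`. -/
theorem IsTypeB.exists_flip (h : IsTypeB e) (k : Fin (n + 1)) :
    ∃ w : P.weylGroup, ActsBy e (w • ·) 1 (fun j => if j = k then -1 else 1) := by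
  induction k using Fin.reverseInduction with
  | last => exact ⟨weylGroup.ofIdx P (e (Fin.last n)), h.actsBy_reflection_last⟩
  | cast j ih =>
    obtain ⟨w, hact⟩ := ih
    have hs : ActsBy e (weylGroup.ofIdx P (e j.castSucc) • ·) _ _ :=
      h.actsBy_reflection_castSucc j
    refine ⟨weylGroup.ofIdx P (e j.castSucc) * w * weylGroup.ofIdx P (e j.castSucc), fun k => ?_⟩
    refine (((hs.mul hact).mul hs) k).trans ?_
    rcases eq_or_ne k j.castSucc with rfl | h1
    · simp
    rcases eq_or_ne k j.succ with rfl | h2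
    · simp [Fin.castSucc_lt_succ.ne, Fin.castSucc_lt_succ.ne']
    · simp [h1, h2, Equiv.swap_apply_of_ne_of_ne]

/-- The heights n + 1 - k of the ε_k are positive and strictly decreasing. Summing the hypotheses
shows that w ε_k has height of sign `u` for k ≥ m, which fixes the signs; comparing neighbouring
heights then makes the permutation increasing, hence trivial. The case `u = 1` characterizes the
identity, the case `u = -1` the longest element. -/
theorem IsTypeB.smul_eps_eq_of_sign (h : IsTypeB e) {m : ℕ} {w : P.weylGroup}
    (hw : w ∈ parabolic e m) (u : ℤˣ)
    (hpos : ∀ k : Fin (n + 1), m ≤ k → 0 < sgn u * htForm b (w • P.root (e k))) :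
    ActsBy e (w • ·) 1 (fun j => if m ≤ j then u else 1) := by
  obtain ⟨σ, s, hact⟩ := h.exists_actsBy w
  have hact' (k) : w • eps e k = sgn (s k) • eps e (σ k) := hact k
  have hht (k : Fin (n + 1)) : 0 < htForm b (eps e k) := by
    rw [htForm_eps]
    have : ((k : ℕ) : ℝ) < n + 1 := by exact_mod_cast k.2
    linarith
  have hfix (k : Fin (n + 1)) (hk : (k : ℕ) < m) : s k = 1 ∧ σ k = k := by
    have h1 := h.smul_eps_of_mem_parabolic hw hk
    rw [hact' k] at h1
    have h2 : σ k = k := by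
      by_contra hne
      have := congrArg (fun x => (epsBasis e).repr x (σ k)) h1
      simp only [← epsBasis_apply, map_smul, Module.Basis.repr_self] at this
      rcases Int.units_eq_one_or (s k) with h3 | h3 <;> simp [h3, Ne.symm hne] at this
    refine ⟨?_, h2⟩
    rw [h2] at h1
    have := congrArg (htForm b) h1
    have h0 := hht k
    rcases Int.units_eq_one_or (s k) with h3 | h3
    · exact h3
    · simp [h3] at this; linarith
  have hsign (k : Fin (n + 1)) (hk : m ≤ k) : 0 < sgn u * htForm b (w • eps e k) := by
    induction k using Fin.reverseInduction with
    | last => rw [eps_last]; exact hpos _ hk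
    | cast j ih =>
      rw [eps_castSucc, smul_add, map_add, mul_add]
      exact add_pos (hpos _ hk) (ih (hk.trans (by simp)))
  have hs (k : Fin (n + 1)) (hk : m ≤ k) : s k = u := by
    have h1 := hsign k hk
    rw [hact' k, map_smul, smul_eq_mul] at h1
    have h0 := hht (σ k)
    rcases Int.units_eq_one_or (s k) with h3 | h3 <;>
      rcases Int.units_eq_one_or u with h4 | h4 <;> simp [h3, h4] at h1 ⊢ <;> linarith
  have hσ : σ = 1 := by
    refine perm_eq_one_of_lt_succ fun j => ?_
    by_cases hj : m ≤ j
    · have h1 := hpos j.castSucc hj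
      rw [root_castSucc, smul_sub, hact', hact', hs _ hj, hs j.succ (hj.trans (by simp)), map_sub,
        map_smul, map_smul, htForm_eps, htForm_eps] at h1
      rw [Fin.lt_def]
      rcases Int.units_eq_one_or u with h4 | h4 <;> simpa [h4] using h1
    · push Not at hj
      rw [(hfix j.castSucc hj).2, Fin.lt_def]
      -- If σ(j+1) ≤ j < m, then σ fixes σ(j+1), and injectivity gives σ(j+1) = j+1, a
      -- contradiction.
      by_contra! hle
      have h1 := (hfix (σ j.succ) (by simp at hle; omega)).2
      have h2 := σ.injective h1
      rw [h2] at hle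
      simp at hle
  subst hσ
  intro k
  rw [hact k]
  dsimp only
  split_ifs with hk
  · rw [hs k hk]
  · rw [(hfix k (not_le.1 hk)).1]

theorem IsTypeB.eq_one_of_isPos (h : IsTypeB e) {m : ℕ} {w : P.weylGroup}
    (hw : w ∈ parabolic e m) (hpos : ∀ j ∈ tail e m, b.IsPos (P.weylGroupToPerm w j)) :
    w = 1 := by
  have hact := h.smul_eps_eq_of_sign hw 1 fun k hk => by
    have := hpos _ ⟨k, hk, rfl⟩
    rw [isPos_iff_htForm, ← P.weylGroup_apply_root] at this
    simpa using this
  refine weylGroup_ext (e := e) fun k => (hact k).trans ?_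
  simp

theorem IsTypeB.actsBy_longest (h : IsTypeB e) (m : ℕ) :
    ActsBy e (longest P (tail e m) • ·) 1 (fun j => if m ≤ j then -1 else 1) := by
  have hl : IsLongest (weylGroup.ofIdx P '' tail e m) (longest P (tail e m)) :=
    (exists_isLongest _).choose_spec
  refine h.smul_eps_eq_of_sign hl.1 (-1) fun k hk => ?_
  have := hl.not_isPos (b := b) (tail_subset m) (fun v hv hpos => h.eq_one_of_isPos hv hpos)
    ⟨k, hk, rfl⟩
  rw [not_isPos_iff_htForm, ← P.weylGroup_apply_root] at this
  simpa using this

theorem IsTypeB.actsBy_omega (h : IsTypeB e) :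
    ActsBy e (omega b (e 0) • ·) 1 (fun j => if j = 0 then -1 else 1) := by
  have h0 := h.actsBy_longest 0
  have h1 := h.actsBy_longest 1
  rw [tail_zero] at h0
  rw [tail_one] at h1
  intro k
  refine ((h1.mul h0) k).trans ?_
  rcases eq_or_ne k 0 with rfl | hk
  · simp
  · have : 1 ≤ (k : ℕ) := by
      rw [Nat.one_le_iff_ne_zero]; exact fun h => hk (Fin.ext h)
    simp [this, hk]

/-! ### Every vector of the expected shape is a root. -/

theorem smul_mem_range_root (w : P.weylGroup) {x : E} (hx : x ∈ Set.range P.root) :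
    w • x ∈ Set.range P.root := by
  obtain ⟨i, rfl⟩ := hx
  exact ⟨_, (P.weylGroup_apply_root w i).symm⟩

theorem neg_mem_range_root {x : E} (hx : x ∈ Set.range P.root) : -x ∈ Set.range P.root := by
  obtain ⟨i, rfl⟩ := hx
  exact ⟨P.reflectionPerm i i, by simp⟩

theorem IsTypeB.eps_mem_range_root (h : IsTypeB e) (k : Fin (n + 1)) :
    eps e k ∈ Set.range P.root := by
  induction k using Fin.reverseInduction with
  | last => rw [eps_last]; exact ⟨_, rfl⟩
  | cast j ih =>
    have := smul_mem_range_root (weylGroup.ofIdx P (e j.castSucc)) ih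
    rwa [ofIdx_smul, h.reflection_castSucc_eps, Equiv.swap_apply_right] at this

theorem IsTypeB.sub_mem_range_root_of_lt (h : IsTypeB e) {a c : Fin (n + 1)} (hac : a < c) :
    eps e a - eps e c ∈ Set.range P.root := by
  induction c using Fin.induction with
  | zero => simp at hac
  | succ j ih =>
    rcases (Fin.le_castSucc_iff.2 hac).eq_or_lt with rfl | hlt
    · rw [← root_castSucc]; exact ⟨_, rfl⟩
    · have := smul_mem_range_root (weylGroup.ofIdx P (e j.castSucc)) (ih hlt)
      rwa [ofIdx_smul, map_sub, h.reflection_castSucc_eps, h.reflection_castSucc_eps,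
        Equiv.swap_apply_left, Equiv.swap_apply_of_ne_of_ne hlt.ne hac.ne] at this

theorem IsTypeB.sub_mem_range_root (h : IsTypeB e) {a c : Fin (n + 1)} (hac : a ≠ c) :
    eps e a - eps e c ∈ Set.range P.root := by
  rcases hac.lt_or_gt with h1 | h1
  · exact h.sub_mem_range_root_of_lt h1
  · rw [← neg_sub]; exact neg_mem_range_root (h.sub_mem_range_root_of_lt h1)

/-- The sign change of ε_c turns the root ε_a - ε_c into ε_a + ε_c. -/
theorem IsTypeB.add_mem_range_root (h : IsTypeB e) {a c : Fin (n + 1)} (hac : a ≠ c) :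
    eps e a + eps e c ∈ Set.range P.root := by
  obtain ⟨w, hw⟩ := h.exists_flip c
  have hw' (k) : w • eps e k = _ := hw k
  have := smul_mem_range_root w (h.sub_mem_range_root hac)
  rw [smul_sub, hw', hw'] at this
  simpa [hac] using this

/-! ### The highest root and the fundamental alcove -/

theorem eps_mem_closure (k : Fin (n + 1)) :
    eps e k ∈ AddSubmonoid.closure (P.root '' b.support) :=
  sum_mem fun j _ => AddSubmonoid.subset_closure ⟨_, (e j).2, rfl⟩

theorem eps_sub_mem_closure {a c : Fin (n + 1)} (hac : a ≤ c) :
    eps e a - eps e c ∈ AddSubmonoid.closure (P.root '' b.support) := by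
  have hsub : Finset.Ici c ⊆ Finset.Ici a := Finset.Ici_subset_Ici.2 hac
  rw [eps, eps, ← Finset.sum_sdiff hsub, add_sub_cancel_right]
  exact sum_mem fun j _ => AddSubmonoid.subset_closure ⟨_, (e j).2, rfl⟩

theorem eps_add_eps_sub_mem_closure {o a c : Fin (n + 1)} (ho : (o : ℕ) = 1) (hac : a < c) :
    eps e 0 + eps e o - (eps e a + eps e c) ∈ AddSubmonoid.closure (P.root '' b.support) := by
  rw [add_sub_add_comm]
  refine add_mem (eps_sub_mem_closure (Fin.zero_le a)) (eps_sub_mem_closure ?_)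
  rw [Fin.le_def]; rw [Fin.lt_def] at hac; omega

/-- Changing a minus sign to plus adds 2ε_a, and lowering an index adds simple roots, so ε_0 + ε_1
dominates every vector of root shape. The index `o` is 1; its existence encodes rank at least 2. -/
theorem IsShape.sub_mem_closure {o : Fin (n + 1)} (ho : (o : ℕ) = 1) {x : E}
    (hx : IsShape e x) :
    eps e 0 + eps e o - x ∈ AddSubmonoid.closure (P.root '' b.support) := by
  have le (u : ℤˣ) (a : Fin (n + 1)) :
      eps e a - sgn u • eps e a ∈ AddSubmonoid.closure (P.root '' b.support) := by
    rcases Int.units_eq_one_or u with rfl | rfl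
    · simp
    · simpa using add_mem (eps_mem_closure (e := e) a) (eps_mem_closure a)
  induction hx with
  | short u a =>
    have : eps e 0 + eps e o - sgn u • eps e a =
        (eps e 0 - eps e a) + eps e o + (eps e a - sgn u • eps e a) := by abel
    rw [this]
    exact add_mem (add_mem (eps_sub_mem_closure (Fin.zero_le a)) (eps_mem_closure o)) (le u a)
  | long u v a c hac =>
    have : eps e 0 + eps e o - (sgn u • eps e a + sgn v • eps e c) =
        (eps e 0 + eps e o - (eps e a + eps e c)) + (eps e a - sgn u • eps e a) +
          (eps e c - sgn v • eps e c) := by abel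
    rw [this]
    refine add_mem (add_mem ?_ (le u a)) (le v c)
    rcases hac.lt_or_gt with h1 | h1
    · exact eps_add_eps_sub_mem_closure ho h1
    · rw [add_comm (eps e a)]; exact eps_add_eps_sub_mem_closure ho h1

theorem eq_zero_of_mem_closure_of_neg_mem {x : E}
    (hx : x ∈ AddSubmonoid.closure (P.root '' b.support))
    (hx' : -x ∈ AddSubmonoid.closure (P.root '' b.support)) : x = 0 := by
  have key (x : E) (hx : x ∈ AddSubmonoid.closure (P.root '' b.support)) :
      ∀ i, 0 ≤ b.toWeightBasis.repr x i := by
    intro i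
    induction hx using AddSubmonoid.closure_induction with
    | mem y hy =>
      obtain ⟨j, hj, rfl⟩ := hy
      rw [b.toWeightBasis_repr_root ⟨j, hj⟩]
      by_cases hij : (⟨j, hj⟩ : b.support) = i <;> simp [hij]
    | zero => simp
    | add y z _ _ hy hz => simpa using add_nonneg hy hz
  apply b.toWeightBasis.repr.injective
  ext i
  have h1 := key x hx i
  have h2 := key _ hx' i
  simp at h2 ⊢
  linarith

/-- Two roots that dominate each other agree, because the cone of nonnegative combinations of simple
roots is pointed. -/
theorem IsTypeB.isHighestRoot_iff (h : IsTypeB e) {o : Fin (n + 1)} (ho : (o : ℕ) = 1) (k : ι) :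
    IsHighestRoot b k ↔ P.root k = eps e 0 + eps e o := by
  have hne : (0 : Fin (n + 1)) ≠ o := by rintro rfl; simp at ho
  obtain ⟨i, hi⟩ := h.add_mem_range_root hne
  constructor
  · intro hk
    have h1 := hk i
    have h2 := (h.isShape_root k).sub_mem_closure ho
    rw [hi] at h1
    rw [← neg_sub] at h2
    exact sub_eq_zero.1 (eq_zero_of_mem_closure_of_neg_mem h1 h2)
  · intro hk j
    rw [hk]
    exact (h.isShape_root j).sub_mem_closure ho

theorem IsTypeB.mem_fundamentalAlcove_iff (h : IsTypeB e) {o : Fin (n + 1)} (ho : (o : ℕ) = 1)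
    (x : E) : x ∈ fundamentalAlcove b ↔
      (∀ j : Fin n, ⟪eps e j.succ, x⟫ < ⟪eps e j.castSucc, x⟫) ∧ 0 < ⟪eps e (Fin.last n), x⟫ ∧
        ⟪eps e 0, x⟫ + ⟪eps e o, x⟫ < 1 := by
  have hne : (0 : Fin (n + 1)) ≠ o := by rintro rfl; simp at ho
  obtain ⟨i, hi⟩ := h.add_mem_range_root hne
  have hsimple : (∀ i ∈ b.support, 0 < ⟪P.root i, x⟫) ↔
      (∀ j : Fin n, ⟪eps e j.succ, x⟫ < ⟪eps e j.castSucc, x⟫) ∧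
        0 < ⟪eps e (Fin.last n), x⟫ := by
    constructor
    · intro hx
      refine ⟨fun j => ?_, ?_⟩
      · have := hx _ (e j.castSucc).2
        rwa [root_castSucc, inner_sub_left, sub_pos] at this
      · rw [eps_last]; exact hx _ (e (Fin.last n)).2
    · rintro ⟨h1, h2⟩ i hi
      obtain ⟨k, hk⟩ := e.surjective ⟨i, hi⟩
      have hk' : ((e k : b.support) : ι) = i := by rw [hk]
      rw [← hk']
      induction k using Fin.lastCases with
      | last => rwa [← eps_last]
      | cast j => rw [root_castSucc, inner_sub_left, sub_pos]; exact h1 j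
  rw [fundamentalAlcove, Set.mem_ofPred_eq, hsimple, and_assoc]
  refine and_congr_right fun _ => and_congr_right fun _ => ?_
  rw [← inner_add_left, ← hi]
  constructor
  · exact fun hx => hx i ((h.isHighestRoot_iff ho i).2 hi)
  · intro hx k hk
    rwa [(h.isHighestRoot_iff ho k).1 hk, ← hi]

/-! ### Coordinates (ε_k, x) on the space and on the coweight lattice. -/

theorem IsTypeB.mem_coweightLattice_iff (h : IsTypeB e) (x : E) :
    x ∈ coweightLattice P ↔ ∀ k, ∃ m : ℤ, ⟪eps e k, x⟫ = m := by
  constructor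
  · intro hx k
    obtain ⟨i, hi⟩ := h.eps_mem_range_root k
    rw [← hi]
    exact hx i
  · intro hx i
    have key (u : ℤˣ) (a) : ∃ m : ℤ, ⟪sgn u • eps e a, x⟫ = m := by
      obtain ⟨m, hm⟩ := hx a
      exact ⟨u * m, by rw [real_inner_smul_left, hm]; simp [sgn]⟩
    have := h.isShape_root i
    generalize P.root i = y at this
    induction this with
    | short u a => exact key u a
    | long u v a c _ =>
      obtain ⟨m, hm⟩ := key u a
      obtain ⟨m', hm'⟩ := key v c
      exact ⟨m + m', by rw [inner_add_left, hm, hm']; push_cast; rfl⟩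

theorem exists_inner_eps_eq (e : Fin (n + 1) ≃ b.support) (v : Fin (n + 1) → ℝ) :
    ∃ x : E, ∀ k, ⟪eps e k, x⟫ = v k := by
  have : FiniteDimensional ℝ E := (epsBasis e).finiteDimensional_of_finite
  have : CompleteSpace E := FiniteDimensional.complete ℝ E
  let f : E →L[ℝ] ℝ := LinearMap.toContinuousLinearMap ((epsBasis e).constr ℝ v)
  refine ⟨(InnerProductSpace.toDual ℝ E).symm f, fun k => ?_⟩
  rw [real_inner_comm, InnerProductSpace.toDual_symm_apply]
  change (epsBasis e).constr ℝ v (eps e k) = v k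
  rw [← epsBasis_apply, Module.Basis.constr_basis]

theorem ext_inner_basis {κ : Type*} (B : Module.Basis κ ℝ E) {x y : E}
    (hxy : ∀ k, ⟪B k, x⟫ = ⟪B k, y⟫) : x = y := by
  refine ext_inner_left ℝ fun v => ?_
  have : (innerₗ E).flip x = (innerₗ E).flip y := B.ext fun k => hxy k
  exact LinearMap.congr_fun this v

theorem ext_inner_eps {x y : E} (hxy : ∀ k, ⟪eps e k, x⟫ = ⟪eps e k, y⟫) : x = y := by
  refine ext_inner_basis (epsBasis e) fun k => ?_
  rw [epsBasis_apply]; exact hxy k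

theorem ActsBy.inner_eps_smul [IsEuclidean P] {w : P.weylGroup} {σ s}
    (hw : ActsBy e (w • ·) σ s) (k : Fin (n + 1)) (x : E) :
    ⟪eps e (σ k), w • x⟫ = sgn (s k) * ⟪eps e k, x⟫ := by
  have h1 : w • eps e k = sgn (s k) • eps e (σ k) := hw k
  rw [← inner_smul_smul P w (eps e k) x, h1, real_inner_smul_left, ← mul_assoc]
  rcases Int.units_eq_one_or (s k) with h2 | h2 <;> simp [h2]

/-- The pairings of x - y with the simple roots are integers strictly between -1 and 1. This gives
the uniqueness behind the action on P^⋄. -/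
theorem eq_of_mem_parallelepiped {x y : E} (hx : x ∈ parallelepiped b)
    (hy : y ∈ parallelepiped b) (hxy : x - y ∈ coweightLattice P) : x = y := by
  refine ext_inner_basis b.toWeightBasis fun i => ?_
  rw [b.toWeightBasis_apply]
  obtain ⟨m, hm⟩ := hxy i
  obtain ⟨h1, h2⟩ := hx i i.2
  obtain ⟨h3, h4⟩ := hy i i.2
  rw [inner_sub_right] at hm
  have h5 : (m : ℝ) < 1 := by linarith
  have h6 : (-1 : ℝ) < m := by linarith
  have h7 : m = 0 := by
    have h5' : m < 1 := by exact_mod_cast h5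
    have h6' : -1 < m := by exact_mod_cast h6
    omega
  rw [h7] at hm
  simpa [sub_eq_zero] using hm

/-! ### The stabilizer of the fundamental alcove. -/

section alcove

variable {o : Fin (n + 1)} {x : E}

theorem IsTypeB.strictAnti_of_mem (h : IsTypeB e) (ho : (o : ℕ) = 1)
    (hx : x ∈ fundamentalAlcove b) : StrictAnti fun k => ⟪eps e k, x⟫ :=
  Fin.strictAnti_iff_succ_lt.2 ((h.mem_fundamentalAlcove_iff ho x).1 hx).1

theorem IsTypeB.pos_of_mem (h : IsTypeB e) (ho : (o : ℕ) = 1)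
    (hx : x ∈ fundamentalAlcove b) (k : Fin (n + 1)) : 0 < ⟪eps e k, x⟫ :=
  ((h.mem_fundamentalAlcove_iff ho x).1 hx).2.1.trans_le
    ((h.strictAnti_of_mem ho hx).antitone (Fin.le_last k))

theorem IsTypeB.lt_one_of_mem (h : IsTypeB e) (ho : (o : ℕ) = 1)
    (hx : x ∈ fundamentalAlcove b) (k : Fin (n + 1)) : ⟪eps e k, x⟫ < 1 := by
  have h1 := (h.strictAnti_of_mem ho hx).antitone (Fin.zero_le k)
  have h2 := ((h.mem_fundamentalAlcove_iff ho x).1 hx).2.2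
  have h3 := h.pos_of_mem ho hx o
  linarith

theorem IsTypeB.lt_half_of_mem (h : IsTypeB e) (ho : (o : ℕ) = 1)
    (hx : x ∈ fundamentalAlcove b) {k : Fin (n + 1)} (hk : k ≠ 0) : ⟪eps e k, x⟫ < 1 / 2 := by
  have hok : o ≤ k := by
    rw [Fin.le_def, ho, Nat.one_le_iff_ne_zero]; exact fun h => hk (Fin.ext h)
  have ho0 : 0 < o := by rw [Fin.lt_def, ho]; simp
  have h1 := (h.strictAnti_of_mem ho hx).antitone hok
  have h2 := ((h.mem_fundamentalAlcove_iff ho x).1 hx).2.2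
  have h3 := h.strictAnti_of_mem ho hx ho0
  dsimp only at h1 h3
  linarith

theorem IsTypeB.fundamentalAlcove_subset (h : IsTypeB e) (ho : (o : ℕ) = 1) :
    fundamentalAlcove b ⊆ parallelepiped b := by
  intro x hx i hi
  refine ⟨hx.1 i hi, ?_⟩
  obtain ⟨k, hk⟩ := e.surjective ⟨i, hi⟩
  have hk' : ((e k : b.support) : ι) = i := by rw [hk]
  rw [← hk']
  induction k using Fin.lastCases with
  | last => rw [← eps_last]; exact (h.lt_one_of_mem ho hx _).le
  | cast j =>
    rw [root_castSucc, inner_sub_left]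
    linarith [h.lt_one_of_mem ho hx j.castSucc, h.pos_of_mem ho hx j.succ]

/-- The alcove is stable under `x_0 ↦ 1 - x_0`. -/
theorem IsTypeB.exists_mem_one_sub (h : IsTypeB e) (ho : (o : ℕ) = 1)
    (hx : x ∈ fundamentalAlcove b) :
    ∃ y ∈ fundamentalAlcove b, ∀ k, ⟪eps e k, y⟫ =
      if k = 0 then 1 - ⟪eps e k, x⟫ else ⟪eps e k, x⟫ := by
  obtain ⟨y, hy⟩ := exists_inner_eps_eq e
    fun k => if k = 0 then 1 - ⟪eps e k, x⟫ else ⟪eps e k, x⟫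
  refine ⟨y, (h.mem_fundamentalAlcove_iff ho y).2 ?_, hy⟩
  obtain ⟨h1, h2, h3⟩ := (h.mem_fundamentalAlcove_iff ho x).1 hx
  have ho0 : o ≠ 0 := by rintro rfl; simp at ho
  have hl : Fin.last n ≠ 0 := by
    intro hl
    have := o.le_last
    rw [hl, Fin.le_def, ho] at this
    simp at this
  have h4 := h.strictAnti_of_mem ho hx (Fin.pos_iff_ne_zero.2 ho0)
  dsimp only at h4
  refine ⟨fun j => ?_, ?_, ?_⟩
  · rw [hy, hy, if_neg (Fin.succ_ne_zero j)]
    split_ifs with hj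
    · have : j.succ = o := by
        rw [Fin.ext_iff] at hj ⊢
        simp at hj ⊢
        omega
      rw [this, hj]
      linarith
    · exact h1 j
  · rw [hy, if_neg hl]; exact h2
  · rw [hy, hy, if_pos rfl, if_neg ho0]; linarith

/-- Supplies the test point of `IsTypeB.eq_one_or_omega`: the coordinates are proportional to n + 1,
n, …, 1, scaled to stay below 1/2. -/
theorem IsTypeB.exists_mem_fundamentalAlcove (h : IsTypeB e) (ho : (o : ℕ) = 1) :
    ∃ y ∈ fundamentalAlcove b, ∀ k, ⟪eps e k, y⟫ < 1 / 2 := by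
  obtain ⟨y, hy⟩ := exists_inner_eps_eq e
    fun k => ((n : ℝ) + 1 - (k : ℕ)) / (2 * (n + 2))
  have hn : (0 : ℝ) < 2 * (n + 2) := by positivity
  refine ⟨y, (h.mem_fundamentalAlcove_iff ho y).2 ⟨fun j => ?_, ?_, ?_⟩, fun k => ?_⟩
  · rw [hy, hy, div_lt_div_iff_of_pos_right hn]; simp
  · rw [hy]; simp; positivity
  · rw [hy, hy, ← add_div, div_lt_one hn, ho]; simp; linarith
  · rw [hy, div_lt_iff₀ hn]; linarith [((k : ℕ).cast_nonneg : (0 : ℝ) ≤ (k : ℕ))]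

theorem IsTypeB.one_mem_alcoveStabilizer (h : IsTypeB e) (ho : (o : ℕ) = 1) :
    1 ∈ alcoveStabilizer b := by
  ext y
  constructor
  · rintro ⟨hy, x, hx, hyx⟩
    rw [one_smul] at hyx
    rwa [eq_of_mem_parallelepiped hy (h.fundamentalAlcove_subset ho hx) hyx]
  · intro hy
    exact ⟨h.fundamentalAlcove_subset ho hy, y, hy, by simp [zero_mem]⟩

variable [IsEuclidean P]

theorem ActsBy.inner_eps_smul_of_flip {w : P.weylGroup}
    (hw : ActsBy e (w • ·) 1 (fun j => if j = 0 then -1 else 1)) (k : Fin (n + 1)) (x : E) :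
    ⟪eps e k, w • x⟫ = if k = 0 then -⟪eps e k, x⟫ else ⟪eps e k, x⟫ := by
  refine (hw.inner_eps_smul k x).trans ?_
  split_ifs <;> simp

theorem IsTypeB.omega_mem_alcoveStabilizer (h : IsTypeB e) (ho : (o : ℕ) = 1) :
    omega b (e 0) ∈ alcoveStabilizer b := by
  have hw := fun k x => h.actsBy_omega.inner_eps_smul_of_flip k x
  have key (x y : E) (hxy : ∀ k, ⟪eps e k, y⟫ =
      if k = 0 then 1 - ⟪eps e k, x⟫ else ⟪eps e k, x⟫) :
      y - omega b (e 0) • x ∈ coweightLattice P := by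
    rw [h.mem_coweightLattice_iff]
    intro k
    -- The difference of 1 - x_0 and -x_0 is 1; the other coordinates agree.
    refine ⟨if k = 0 then 1 else 0, ?_⟩
    rw [inner_sub_right, hw, hxy]
    split_ifs <;> simp
  ext y
  constructor
  · rintro ⟨hy, x, hx, hyx⟩
    obtain ⟨z, hz, hzx⟩ := h.exists_mem_one_sub ho hx
    have := sub_mem hyx (key x z hzx)
    rw [sub_sub_sub_cancel_right] at this
    rwa [eq_of_mem_parallelepiped hy (h.fundamentalAlcove_subset ho hz) this]
  · intro hy
    obtain ⟨x, hx, hxy⟩ := h.exists_mem_one_sub ho hy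
    refine ⟨h.fundamentalAlcove_subset ho hy, x, hx, key x y fun k => ?_⟩
    rw [hxy]
    split_ifs <;> simp

theorem IsTypeB.eq_one_or_omega (h : IsTypeB e) (ho : (o : ℕ) = 1) {w : P.weylGroup}
    (hw : w ∈ alcoveStabilizer b) : w = 1 ∨ w = omega b (e 0) := by
  obtain ⟨y, hy, hy2⟩ := h.exists_mem_fundamentalAlcove ho
  obtain ⟨-, x, hx, hyx⟩ : y ∈ alcoveImage b w (fundamentalAlcove b) := by
    rw [show alcoveImage b w (fundamentalAlcove b) = fundamentalAlcove b from hw]; exact hy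
  obtain ⟨σ, s, hact⟩ := h.exists_actsBy w
  rw [h.mem_coweightLattice_iff] at hyx
  -- Modulo 1, coordinate σ(k) of y is ±x_k, and all coordinates lie in (0, 1): the difference is 0
  -- for the plus sign and 1 for the minus sign.
  have hcoord (k) : (s k = 1 ∧ ⟪eps e (σ k), y⟫ = ⟪eps e k, x⟫) ∨
      (s k = -1 ∧ ⟪eps e (σ k), y⟫ = 1 - ⟪eps e k, x⟫) := by
    obtain ⟨m, hm⟩ := hyx (σ k)
    rw [inner_sub_right, hact.inner_eps_smul] at hm
    have h1 := h.pos_of_mem ho hx k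
    have h2 := h.lt_one_of_mem ho hx k
    have h3 := h.pos_of_mem ho hy (σ k)
    have h4 := hy2 (σ k)
    rcases Int.units_eq_one_or (s k) with hs | hs <;> rw [hs] at hm <;> simp at hm
    · refine .inl ⟨hs, ?_⟩
      have h5 : -1 < m := by
        have : (-1 : ℝ) < m := by linarith
        exact_mod_cast this
      have h6 : m < 1 := by
        have : (m : ℝ) < 1 := by linarith
        exact_mod_cast this
      obtain rfl : m = 0 := by omega
      simp at hm; linarith
    · refine .inr ⟨hs, ?_⟩
      have h5 : 0 < m := by
        have : (0 : ℝ) < m := by linarith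
        exact_mod_cast this
      have h6 : m < 2 := by
        have : (m : ℝ) < 2 := by linarith
        exact_mod_cast this
      obtain rfl : m = 1 := by omega
      simp at hm; linarith
  -- For k ≠ 0 both coordinates are below 1/2, so they cannot add up to 1.
  have hcoord' (k) (hk : k ≠ 0) : s k = 1 ∧ ⟪eps e (σ k), y⟫ = ⟪eps e k, x⟫ := by
    refine (hcoord k).resolve_right fun hs => ?_
    linarith [hs.2, h.lt_half_of_mem ho hx hk, hy2 (σ k)]
  have ho0 : o ≠ 0 := by rintro rfl; simp at ho
  have hσ : σ = 1 := by
    refine perm_eq_one_of_lt_succ fun j => ?_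
    rw [← (h.strictAnti_of_mem ho hy).lt_iff_gt]
    rw [(hcoord' _ (Fin.succ_ne_zero j)).2]
    have hlt : ⟪eps e j.succ, x⟫ < ⟪eps e j.castSucc, x⟫ :=
      h.strictAnti_of_mem ho hx Fin.castSucc_lt_succ
    rcases hcoord j.castSucc with ⟨-, h1⟩ | ⟨hs, h1⟩
    · rwa [h1]
    · rw [h1]
      have hj : j.castSucc = 0 := by
        by_contra hne
        rw [(hcoord' _ hne).1] at hs
        exact absurd hs (by decide)
      have hjo : j.succ = o := by
        rw [Fin.ext_iff] at hj ⊢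
        simp at hj ⊢
        omega
      rw [hj, hjo]
      -- With a minus sign at 0, the required inequality x_1 < 1 - x_0 is the wall condition of the
      -- highest root.
      linarith [((h.mem_fundamentalAlcove_iff ho x).1 hx).2.2]
  subst hσ
  rcases hcoord 0 with ⟨hs, -⟩ | ⟨hs, -⟩
  · left
    refine weylGroup_ext (e := e) fun k => (hact k).trans ?_
    have : s k = 1 := by
      rcases eq_or_ne k 0 with rfl | hk
      · exact hs
      · exact (hcoord' k hk).1
    simp [this]
  · right
    refine weylGroup_ext (e := e) fun k => (hact k).trans (Eq.trans ?_ (h.actsBy_omega k).symm)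
    rcases eq_or_ne k 0 with rfl | hk
    · simp [hs]
    · simp [hk, (hcoord' k hk).1]

theorem IsTypeB.alcoveStabilizer_eq (h : IsTypeB e) (ho : (o : ℕ) = 1) :
    alcoveStabilizer b = {1, omega b (e 0)} := by
  ext w
  constructor
  · exact fun hw => h.eq_one_or_omega ho hw
  · rintro (rfl | rfl)
    · exact h.one_mem_alcoveStabilizer ho
    · exact h.omega_mem_alcoveStabilizer ho

end alcove

/-! ### Counting regular points in a finite abelian group. -/

section count

variable (X : Type*) [AddCommGroup X] [Fintype X] [DecidableEq X]

/-- The points of `X ^ n` off the toric hyperplanes `x_i = 0` and `x_i = ± x_j`. -/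
def regular (n : ℕ) : Finset (Fin n → X) :=
  {v | (∀ i, v i ≠ 0) ∧ ∀ i j, i ≠ j → v i ≠ v j ∧ v i ≠ -v j}

/-- The points of `X ^ n` off the toric hyperplanes `2 x_i = 0` and `x_i = ± x_j`. -/
def strictlyRegular (n : ℕ) : Finset (Fin n → X) :=
  {v | (∀ i, v i ≠ -v i) ∧ ∀ i j, i ≠ j → v i ≠ v j ∧ v i ≠ -v j}

/-- The elements of `X` that are not equal to their negatives. -/
def nonInvolutions : Finset X := {x | x ≠ -x}

variable {X} {n : ℕ}

theorem mem_regular {v : Fin n → X} :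
    v ∈ regular X n ↔ (∀ i, v i ≠ 0) ∧ ∀ i j, i ≠ j → v i ≠ v j ∧ v i ≠ -v j := by
  simp [regular]

theorem mem_strictlyRegular {v : Fin n → X} :
    v ∈ strictlyRegular X n ↔
      (∀ i, v i ≠ -v i) ∧ ∀ i j, i ≠ j → v i ≠ v j ∧ v i ≠ -v j := by
  simp [strictlyRegular]

theorem cons_mem_strictlyRegular {v : Fin n → X} {x : X} :
    (Fin.cons x v : Fin (n + 1) → X) ∈ strictlyRegular X (n + 1) ↔
      v ∈ strictlyRegular X n ∧ x ≠ -x ∧ ∀ i, x ≠ v i ∧ x ≠ -v i := by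
  simp only [mem_strictlyRegular, Fin.forall_fin_succ, Fin.cons_zero, Fin.cons_succ]
  constructor
  · rintro ⟨⟨h1, h2⟩, ⟨-, h3⟩, h4⟩
    exact ⟨⟨h2, fun i j hij => (h4 i).2 j (by simpa using hij)⟩, h1,
      fun i => h3 i (Fin.succ_ne_zero i).symm⟩
  · rintro ⟨⟨h1, h2⟩, h3, h4⟩
    refine ⟨⟨h3, h1⟩, ⟨by simp, fun i _ => h4 i⟩, fun i => ⟨fun _ => ⟨(h4 i).1.symm, ?_⟩, ?_⟩⟩
    · exact fun h => (h4 i).2 (by rw [h, neg_neg])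
    · exact fun j hij => h2 i j (by simpa using hij)

/-- The 2n elements ±v_i are pairwise distinct and none equals its own negative, so exactly they are
excluded for a new coordinate. -/
theorem card_extensions {v : Fin n → X} (hv : v ∈ strictlyRegular X n) :
    (({x | x ≠ -x ∧ ∀ i, x ≠ v i ∧ x ≠ -v i} : Finset X).card : ℤ) =
      (nonInvolutions X).card - 2 * n := by
  obtain ⟨h1, h2⟩ := mem_strictlyRegular.1 hv
  have hinj : Function.Injective v := fun i j hij => by
    by_contra hne; exact (h2 i j hne).1 hij
  have hdisj : Disjoint (Finset.univ.image v) (Finset.univ.image fun i => -v i) := by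
    rw [Finset.disjoint_left]
    simp only [Finset.mem_image, Finset.mem_univ, true_and, not_exists]
    rintro _ ⟨i, rfl⟩ j hij
    rcases eq_or_ne i j with rfl | hne
    · exact h1 i hij.symm
    · exact (h2 i j hne).2 hij.symm
  have hsub : Finset.univ.image v ∪ Finset.univ.image (fun i => -v i) ⊆ nonInvolutions X := by
    intro x
    simp only [Finset.mem_union, Finset.mem_image, Finset.mem_univ, true_and, nonInvolutions,
      Finset.mem_filter]
    rintro (⟨i, rfl⟩ | ⟨i, rfl⟩)
    · exact h1 i
    · rw [neg_neg]; exact (h1 i).symm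
  have hcard : (Finset.univ.image v ∪ Finset.univ.image fun i => -v i).card = 2 * n := by
    rw [Finset.card_union_of_disjoint hdisj, Finset.card_image_of_injective _ hinj,
      Finset.card_image_of_injective (f := fun i => -v i) _ (neg_injective.comp hinj),
      Finset.card_univ,
      Fintype.card_fin]
    ring
  have heq : ({x | x ≠ -x ∧ ∀ i, x ≠ v i ∧ x ≠ -v i} : Finset X) =
      nonInvolutions X \ (Finset.univ.image v ∪ Finset.univ.image fun i => -v i) := by
    ext x
    simp only [Finset.mem_filter, Finset.mem_univ, true_and, nonInvolutions, Finset.mem_sdiff,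
      Finset.mem_union, Finset.mem_image, not_or, not_exists, ← forall_and]
    simp only [ne_eq, eq_comm]
  have := Finset.card_sdiff_add_card_eq_card hsub
  rw [heq]
  omega

/-- Fibre over the tail of the tuple. The integer product stays correct when factors become
negative: the fibre count is used only over existing tuples, and an empty set stays empty. -/
theorem card_strictlyRegular (n : ℕ) :
    ((strictlyRegular X n).card : ℤ) =
      ∏ i ∈ Finset.range n, (((nonInvolutions X).card : ℤ) - 2 * i) := by
  induction n with
  | zero => simp [strictlyRegular]
  | succ n ih =>
    have hmaps : ∀ w ∈ strictlyRegular X (n + 1), Fin.tail w ∈ strictlyRegular X n := by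
      intro w hw
      rw [← Fin.cons_self_tail w, cons_mem_strictlyRegular] at hw
      exact hw.1
    have hfib : ∀ v ∈ strictlyRegular X n,
        ((({w ∈ strictlyRegular X (n + 1) | Fin.tail w = v} : Finset _).card : ℕ) : ℤ) =
          (nonInvolutions X).card - 2 * n := by
      intro v hv
      rw [← card_extensions hv, Nat.cast_inj]
      refine Finset.card_nbij' (fun w => w 0) (fun x => Fin.cons x v) ?_ ?_ ?_ ?_
      · intro w hw
        obtain ⟨h1, rfl⟩ := Finset.mem_filter.1 hw
        rw [← Fin.cons_self_tail w, cons_mem_strictlyRegular] at h1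
        simpa using h1.2
      · intro x hx
        have hx' := (Finset.mem_filter.1 hx).2
        exact Finset.mem_filter.2 ⟨cons_mem_strictlyRegular.2 ⟨hv, hx'⟩, Fin.tail_cons _ _⟩
      · intro w hw
        obtain ⟨-, rfl⟩ := Finset.mem_filter.1 hw
        exact Fin.cons_self_tail w
      · intro x _
        rfl
    rw [Finset.prod_range_succ, ← ih, Finset.card_eq_sum_card_fiberwise hmaps, Nat.cast_sum,
      Finset.sum_congr rfl hfib, Finset.sum_const, nsmul_eq_mul]

theorem strictlyRegular_eq_regular (hX : ∀ x : X, x = -x → x = 0) :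
    regular X n = strictlyRegular X n := by
  ext v
  rw [mem_regular, mem_strictlyRegular]
  refine and_congr_left fun _ => forall_congr' fun i => not_congr ⟨fun h => ?_, hX _⟩
  simp [h]

variable {t : X}

/-- Once one coordinate is `t`, the others must avoid `t` as well as 0, which is exactly the
condition of differing from their negatives. -/
theorem insertNth_mem_regular (ht : t ≠ 0) (hX : ∀ x : X, x = -x ↔ x = 0 ∨ x = t)
    {v : Fin n → X} (i : Fin (n + 1)) :
    (i.insertNth t v : Fin (n + 1) → X) ∈ regular X (n + 1) ↔ v ∈ strictlyRegular X n := by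
  have htt : t = -t := (hX t).2 (.inr rfl)
  simp only [mem_regular, mem_strictlyRegular, Fin.forall_iff_succAbove i, Fin.insertNth_apply_same,
    Fin.insertNth_apply_succAbove]
  constructor
  · rintro ⟨⟨-, h1⟩, ⟨-, h2⟩, h3⟩
    refine ⟨fun j hj => ?_, fun j k hjk => (h3 j).2 k (by simpa using hjk)⟩
    rcases (hX _).1 hj with h4 | h4
    · exact h1 j h4
    · exact (h2 j (Fin.succAbove_ne i j).symm).1 h4.symm
  · rintro ⟨h1, h2⟩
    have h0 (j) : v j ≠ 0 := fun h => h1 j (by simp [h])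
    have h3 (j) : t ≠ v j := fun h => h1 j (h ▸ htt)
    have h4 (j) : t ≠ -v j := fun h => h3 j (by rw [htt, h, neg_neg])
    refine ⟨⟨ht, h0⟩, ⟨by simp, fun j _ => ⟨h3 j, h4 j⟩⟩,
      fun j => ⟨fun _ => ⟨(h3 j).symm, fun h => h3 j (by rw [h, ← htt])⟩, fun k hjk => ?_⟩⟩
    exact h2 j k (by simpa using hjk)

theorem card_regular_filter_eq (ht : t ≠ 0) (hX : ∀ x : X, x = -x ↔ x = 0 ∨ x = t)
    (i : Fin (n + 1)) :
    ({v ∈ regular X (n + 1) | v i = t} : Finset _).card = (strictlyRegular X n).card := by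
  refine Finset.card_nbij' (fun v => i.removeNth v) (fun v => i.insertNth t v) ?_ ?_ ?_ ?_
  · intro v hv
    obtain ⟨h1, rfl⟩ := Finset.mem_filter.1 hv
    exact (insertNth_mem_regular ht hX i).1 (by simpa using h1)
  · intro v hv
    exact Finset.mem_filter.2 ⟨(insertNth_mem_regular ht hX i).2 hv, by simp⟩
  · intro v hv
    obtain ⟨-, rfl⟩ := Finset.mem_filter.1 hv
    simp
  · intro v _
    simp

/-- A regular tuple takes the value `t` nowhere, or at exactly one of the n + 1 places since its
coordinates are distinct. -/
theorem card_regular_succ (ht : t ≠ 0) (hX : ∀ x : X, x = -x ↔ x = 0 ∨ x = t) :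
    (regular X (n + 1)).card =
      (strictlyRegular X (n + 1)).card + (n + 1) * (strictlyRegular X n).card := by
  have h1 : regular X (n + 1) = strictlyRegular X (n + 1) ∪
      Finset.univ.biUnion fun i => {v ∈ regular X (n + 1) | v i = t} := by
    ext v
    simp only [Finset.mem_union, Finset.mem_biUnion, Finset.mem_univ, true_and, Finset.mem_filter,
      mem_strictlyRegular, hX, not_or, exists_and_left, ne_eq]
    constructor
    · intro hv
      by_cases h : ∃ i, v i = t
      · exact .inr ⟨hv, h⟩
      · push Not at h
        exact .inl ⟨fun i => ⟨(mem_regular.1 hv).1 i, h i⟩, (mem_regular.1 hv).2⟩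
    · rintro (⟨h1, h2⟩ | h)
      · exact mem_regular.2 ⟨fun i => (h1 i).1, h2⟩
      · exact h.1
  have h2 : Disjoint (strictlyRegular X (n + 1))
      (Finset.univ.biUnion fun i => {v ∈ regular X (n + 1) | v i = t}) := by
    rw [Finset.disjoint_left]
    simp only [Finset.mem_biUnion, Finset.mem_univ, true_and, Finset.mem_filter, not_exists,
      not_and, mem_strictlyRegular]
    exact fun v hv i _ hi => hv.1 i ((hX _).2 (.inr hi))
  rw [h1, Finset.card_union_of_disjoint h2, Finset.card_biUnion]
  · simp only [card_regular_filter_eq ht hX]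
    simp
  · intro i _ j _ hij
    refine Finset.disjoint_left.2 fun v hv hv' => ?_
    obtain ⟨h3, h4⟩ := Finset.mem_filter.1 hv
    exact ((mem_regular.1 h3).2 i j hij).1 (h4.trans (Finset.mem_filter.1 hv').2.symm)

end count

/-! ### The counts in ℤ/q for odd and even q. -/

section ZMod

theorem prod_range_add_one_eq_prod_Icc (f : ℕ → ℤ) (n : ℕ) :
    ∏ i ∈ Finset.range n, f (i + 1) = ∏ i ∈ Finset.Icc 1 n, f i := by
  induction n with
  | zero => simp
  | succ n ih => rw [Finset.prod_range_succ, ih, Finset.prod_Icc_succ_top (by omega)]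

variable {q : ℕ}

theorem zmod_eq_neg_iff_of_odd (hq : Odd q) (x : ZMod q) : x = -x ↔ x = 0 := by
  rw [eq_comm, ZMod.neg_eq_self_iff]
  obtain ⟨k, hk⟩ := hq
  refine ⟨fun h => h.resolve_right (by omega), .inl⟩

variable [NeZero q]

theorem exists_zmod_eq_neg_iff_of_even (hq : Even q) :
    ∃ t : ZMod q, t ≠ 0 ∧ ∀ x : ZMod q, x = -x ↔ x = 0 ∨ x = t := by
  obtain ⟨k, hk⟩ := hq
  have hq0 := NeZero.pos q
  have hval : ((k : ℕ) : ZMod q).val = k := ZMod.val_cast_of_lt (by omega)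
  -- The nonzero element equal to its negative is q/2.
  refine ⟨(k : ℕ), fun h => ?_, fun x => ?_⟩
  · rw [h, ZMod.val_zero] at hval; omega
  · rw [eq_comm, ZMod.neg_eq_self_iff]
    refine or_congr_right ⟨fun h => ?_, ?_⟩
    · apply ZMod.val_injective
      omega
    · rintro rfl; omega

theorem card_nonInvolutions_of_odd (hq : Odd q) :
    ((nonInvolutions (ZMod q)).card : ℤ) = q - 1 := by
  have : nonInvolutions (ZMod q) = Finset.univ \ {0} := by
    ext x; simp [nonInvolutions, zmod_eq_neg_iff_of_odd hq]
  have hq0 := NeZero.pos q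
  rw [this, Finset.card_sdiff_of_subset (by simp), Finset.card_univ, ZMod.card,
    Finset.card_singleton]
  omega

theorem card_nonInvolutions_of_even (hq : Even q) :
    ((nonInvolutions (ZMod q)).card : ℤ) = q - 2 := by
  obtain ⟨t, ht, hX⟩ := exists_zmod_eq_neg_iff_of_even hq
  have : nonInvolutions (ZMod q) = Finset.univ \ {0, t} := by
    ext x; simp [nonInvolutions, hX]
  have hq0 := NeZero.pos q
  obtain ⟨k, hk⟩ := hq
  rw [this, Finset.card_sdiff_of_subset (by simp), Finset.card_univ, ZMod.card,
    Finset.card_pair ht.symm]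
  omega

theorem card_regular_of_odd (hq : Odd q) (n : ℕ) :
    ((regular (ZMod q) n).card : ℤ) = ∏ i ∈ Finset.Icc 1 n, ((q : ℤ) - (2 * (i : ℤ) - 1)) := by
  rw [strictlyRegular_eq_regular fun x => (zmod_eq_neg_iff_of_odd hq x).1, card_strictlyRegular,
    card_nonInvolutions_of_odd hq, ← prod_range_add_one_eq_prod_Icc]
  refine Finset.prod_congr rfl fun i _ => ?_
  push_cast
  ring

theorem card_strictlyRegular_of_even (hq : Even q) (n : ℕ) :
    ((strictlyRegular (ZMod q) n).card : ℤ) = ∏ i ∈ Finset.Icc 1 n, ((q : ℤ) - 2 * (i : ℤ)) := by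
  rw [card_strictlyRegular, card_nonInvolutions_of_even hq, ← prod_range_add_one_eq_prod_Icc]
  refine Finset.prod_congr rfl fun i _ => ?_
  push_cast
  ring

/-- The last factor is (q - 2(n + 1)) + (n + 1): the second summand counts the places where q/2 can
stand. -/
theorem card_regular_of_even (hq : Even q) (n : ℕ) :
    ((regular (ZMod q) (n + 1)).card : ℤ) =
      (∏ i ∈ Finset.Icc 1 n, ((q : ℤ) - 2 * (i : ℤ))) * ((q : ℤ) - ((n + 1 : ℕ) : ℤ)) := by
  obtain ⟨t, ht, hX⟩ := exists_zmod_eq_neg_iff_of_even hq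
  rw [card_regular_succ ht hX]
  push_cast
  rw [card_strictlyRegular_of_even hq, card_strictlyRegular_of_even hq,
    Finset.prod_Icc_succ_top (by omega)]
  push_cast
  ring

theorem regular_filter_of_odd (hq : Odd q) (n : ℕ) :
    ({v ∈ regular (ZMod q) (n + 1) | v 0 = -v 0} : Finset _) = ∅ := by
  refine Finset.filter_eq_empty_iff.2 fun v hv h => ?_
  exact (mem_regular.1 hv).1 0 ((zmod_eq_neg_iff_of_odd hq _).1 h)

theorem card_regular_filter_of_even (hq : Even q) (n : ℕ) :
    (({v ∈ regular (ZMod q) (n + 1) | v 0 = -v 0} : Finset _).card : ℤ) =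
      ∏ i ∈ Finset.Icc 1 n, ((q : ℤ) - 2 * (i : ℤ)) := by
  obtain ⟨t, ht, hX⟩ := exists_zmod_eq_neg_iff_of_even hq
  rw [← card_strictlyRegular_of_even hq, ← card_regular_filter_eq ht hX 0]
  congr 2
  refine Finset.filter_congr fun v hv => ?_
  rw [hX, or_iff_right ((mem_regular.1 hv).1 0)]

end ZMod

/-! ### The complement modulo q in coordinates and its fixed points. -/

section chi

/-- The integral coordinates `(ε_k, x)` of a point of the coweight lattice. -/
noncomputable def coord (e : Fin (n + 1) ≃ b.support) (x : coweightLattice P)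
    (k : Fin (n + 1)) : ℤ :=
  ⌊⟪eps e k, (x : E)⟫⌋

theorem IsTypeB.coord_cast (h : IsTypeB e) (x : coweightLattice P) (k : Fin (n + 1)) :
    (coord e x k : ℝ) = ⟪eps e k, (x : E)⟫ := by
  obtain ⟨m, hm⟩ := (h.mem_coweightLattice_iff (x : E)).1 x.2 k
  rw [coord, hm, Int.floor_intCast]

theorem IsTypeB.exists_coord_eq (h : IsTypeB e) (v : Fin (n + 1) → ℤ) :
    ∃ x : coweightLattice P, coord e x = v := by
  obtain ⟨x, hx⟩ := exists_inner_eps_eq e fun k => (v k : ℝ)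
  refine ⟨⟨x, (h.mem_coweightLattice_iff x).2 fun k => ⟨_, hx k⟩⟩, ?_⟩
  ext k
  rw [coord, hx, Int.floor_intCast]

theorem IsTypeB.coord_injective (h : IsTypeB e) {x y : coweightLattice P}
    (hxy : coord e x = coord e y) : x = y := by
  refine Subtype.ext (ext_inner_eps (e := e) fun k => ?_)
  rw [← h.coord_cast, ← h.coord_cast, hxy]

theorem IsTypeB.coord_add (h : IsTypeB e) (x y : coweightLattice P) :
    coord e (x + y) = coord e x + coord e y := by
  ext k
  have : (coord e (x + y) k : ℝ) = coord e x k + coord e y k := by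
    simp only [h.coord_cast, AddSubgroup.coe_add, inner_add_right]
  exact_mod_cast this

/-- The coordinates modulo `q`. -/
noncomputable def coordMod (h : IsTypeB e) (q : ℕ) :
    coweightLattice P →+ (Fin (n + 1) → ZMod q) where
  toFun x k := (coord e x k : ZMod q)
  map_zero' := by ext k; simp [coord]
  map_add' x y := by ext k; simp [h.coord_add]

theorem coordMod_apply (h : IsTypeB e) (q : ℕ) (x : coweightLattice P) (k : Fin (n + 1)) :
    coordMod h q x k = (coord e x k : ZMod q) := rfl

theorem coordMod_surjective (h : IsTypeB e) (q : ℕ) : Function.Surjective (coordMod h q) := by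
  intro v
  choose m hm using fun k => ZMod.intCast_surjective (v k)
  obtain ⟨x, hx⟩ := h.exists_coord_eq m
  exact ⟨x, by ext k; rw [coordMod_apply, hx, hm]⟩

theorem ker_coordMod (h : IsTypeB e) (q : ℕ) : (coordMod h q).ker = multiples P q := by
  ext x
  rw [AddMonoidHom.mem_ker]
  constructor
  · intro hx
    have hdvd (k) : ∃ m : ℤ, coord e x k = q * m := by
      rw [← dvd_def, ← ZMod.intCast_zmod_eq_zero_iff_dvd, ← coordMod_apply h, hx]; rfl
    choose m hm using hdvd
    obtain ⟨y, hy⟩ := h.exists_coord_eq m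
    refine ⟨y, h.coord_injective ?_⟩
    ext k
    have : (coord e (q • y) k : ℝ) = q * coord e y k := by
      rw [h.coord_cast, h.coord_cast, AddSubgroup.coe_nsmul, ← Nat.cast_smul_eq_nsmul ℝ,
        real_inner_smul_right]
    rw [hm, ← hy]
    exact_mod_cast this
  · rintro ⟨y, rfl⟩
    ext k
    simp

/-- The class modulo `q` is determined by the coordinates modulo `q`. -/
noncomputable def quotEquiv (h : IsTypeB e) (q : ℕ) :
    coweightLattice P ⧸ multiples P q ≃+ (Fin (n + 1) → ZMod q) :=
  (QuotientAddGroup.quotientAddEquivOfEq (ker_coordMod h q).symm).trans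
    (QuotientAddGroup.quotientKerEquivOfSurjective _ (coordMod_surjective h q))

theorem quotEquiv_mk (h : IsTypeB e) (q : ℕ) (x : coweightLattice P) :
    quotEquiv h q (x : coweightLattice P ⧸ multiples P q) = coordMod h q x := rfl

theorem exists_inner_eq_iff {x y : E} {m : ℤ} (hm : ⟪y, x⟫ = m) (q : ℕ) :
    (∃ k : ℤ, ⟪y, x⟫ = (q : ℝ) * k) ↔ (m : ZMod q) = 0 := by
  rw [ZMod.intCast_zmod_eq_zero_iff_dvd, dvd_def]
  refine exists_congr fun k => ?_
  rw [hm]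
  exact_mod_cast Iff.rfl

/-- Both halves of the description of the roots enter: each of ε_k and ε_k ± ε_l is a root, and no
other roots occur up to sign. -/
theorem IsTypeB.forall_root_iff (h : IsTypeB e) (q : ℕ) [NeZero q] (x : coweightLattice P) :
    (∀ i, ¬ ∃ k : ℤ, ⟪P.root i, (x : E)⟫ = (q : ℝ) * k) ↔
      coordMod h q x ∈ regular (ZMod q) (n + 1) := by
  have hu (u : ℤˣ) (k) : ⟪sgn u • eps e k, (x : E)⟫ = ((u * coord e x k : ℤ) : ℝ) := by
    rw [real_inner_smul_left, ← h.coord_cast]; simp [sgn]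
  rw [mem_regular]
  constructor
  · intro hx
    refine ⟨fun k => ?_, fun k l hkl => ⟨?_, ?_⟩⟩
    · obtain ⟨i, hi⟩ := h.eps_mem_range_root k
      have := hx i
      rwa [hi, exists_inner_eq_iff (h.coord_cast x k).symm] at this
    · obtain ⟨i, hi⟩ := h.sub_mem_range_root hkl
      have := hx i
      rw [hi, exists_inner_eq_iff (m := coord e x k - coord e x l)
        (by rw [inner_sub_left]; push_cast; rw [h.coord_cast, h.coord_cast])] at this
      rw [Int.cast_sub, sub_eq_zero] at this
      exact this
    · obtain ⟨i, hi⟩ := h.add_mem_range_root hkl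
      have := hx i
      rw [hi, exists_inner_eq_iff (m := coord e x k + coord e x l)
        (by rw [inner_add_left]; push_cast; rw [h.coord_cast, h.coord_cast])] at this
      rw [Int.cast_add, add_eq_zero_iff_eq_neg] at this
      exact this
  · rintro ⟨h1, h2⟩ i
    have := h.isShape_root i
    generalize P.root i = y at this
    induction this with
    | short u k =>
      rw [exists_inner_eq_iff (hu u k)]
      rcases Int.units_eq_one_or u with rfl | rfl <;> simpa [coordMod_apply] using h1 k
    | long u v k l hkl =>
      rw [exists_inner_eq_iff (m := u * coord e x k + v * coord e x l)
        (by rw [inner_add_left, hu, hu]; push_cast; rfl)]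
      obtain ⟨h3, h4⟩ := h2 k l hkl
      rw [coordMod_apply, coordMod_apply] at h3 h4
      rw [← sub_ne_zero] at h3
      rw [ne_eq, ← add_eq_zero_iff_eq_neg] at h4
      rcases Int.units_eq_one_or u with rfl | rfl <;>
        rcases Int.units_eq_one_or v with rfl | rfl <;> push_cast
      · simpa using h4
      · simpa [sub_eq_add_neg] using h3
      · intro h5
        exact h3 (by linear_combination -h5)
      · intro h5
        exact h4 (by linear_combination -h5)

theorem IsTypeB.mem_complement_iff (h : IsTypeB e) (q : ℕ) [NeZero q]
    (z : coweightLattice P ⧸ multiples P q) :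
    z ∈ complement P q ↔ quotEquiv h q z ∈ regular (ZMod q) (n + 1) := by
  constructor
  · rintro ⟨x, rfl, hx⟩
    rwa [quotEquiv_mk, ← h.forall_root_iff]
  · intro hz
    obtain ⟨x, rfl⟩ := QuotientAddGroup.mk_surjective z
    exact ⟨x, rfl, (h.forall_root_iff q x).2 hz⟩

variable [IsEuclidean P]

theorem IsTypeB.quotEquiv_modAction_omega (h : IsTypeB e) (q : ℕ)
    (z : coweightLattice P ⧸ multiples P q) (k : Fin (n + 1)) :
    quotEquiv h q (modAction P q (omega b (e 0)) z) k =
      if k = 0 then -quotEquiv h q z k else quotEquiv h q z k := by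
  obtain ⟨x, rfl⟩ := QuotientAddGroup.mk_surjective z
  have key : coord e (latticeAction P (omega b (e 0)) x) k =
      if k = 0 then -coord e x k else coord e x k := by
    have h1 := h.coord_cast (latticeAction P (omega b (e 0)) x) k
    have h2 := h.actsBy_omega.inner_eps_smul_of_flip k (x : E)
    rw [← h.coord_cast] at h2
    rw [← @Int.cast_inj ℝ, h1]
    refine h2.trans ?_
    split_ifs <;> simp
  change ((coord e (latticeAction P (omega b (e 0)) x) k : ℤ) : ZMod q) = _
  rw [key, quotEquiv_mk, coordMod_apply]
  split_ifs <;> simp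

theorem IsTypeB.chi_one (h : IsTypeB e) (q : ℕ) [NeZero q] :
    chi P q 1 = (regular (ZMod q) (n + 1)).card := by
  have hone (z : coweightLattice P ⧸ multiples P q) : modAction P q 1 z = z := by
    obtain ⟨x, rfl⟩ := QuotientAddGroup.mk_surjective z
    change ((latticeAction P 1 x : coweightLattice P) : coweightLattice P ⧸ multiples P q) = _
    congr 1
  rw [chi, ← Set.ncard_coe_finset, ← Set.ncard_image_of_injective _ (quotEquiv h q).injective]
  congr 1
  ext v
  constructor
  · rintro ⟨z, ⟨hz, -⟩, rfl⟩
    exact (h.mem_complement_iff q z).1 hz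
  · intro hv
    refine ⟨(quotEquiv h q).symm v, ⟨(h.mem_complement_iff q _).2 ?_, hone _⟩, by simp⟩
    simpa using hv

theorem IsTypeB.chi_omega (h : IsTypeB e) (q : ℕ) [NeZero q] :
    chi P q (omega b (e 0)) =
      ({v ∈ regular (ZMod q) (n + 1) | v 0 = -v 0} : Finset _).card := by
  have hfix (z : coweightLattice P ⧸ multiples P q) :
      modAction P q (omega b (e 0)) z = z ↔ quotEquiv h q z 0 = -quotEquiv h q z 0 := by
    rw [← (quotEquiv h q).injective.eq_iff, funext_iff]
    simp only [h.quotEquiv_modAction_omega]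
    constructor
    · intro hz
      simpa using (hz 0).symm
    · intro hz k
      split_ifs with hk
      · rw [hk, ← hz]
      · rfl
  rw [chi, ← Set.ncard_coe_finset, ← Set.ncard_image_of_injective _ (quotEquiv h q).injective]
  congr 1
  ext v
  rw [Finset.mem_coe, Finset.mem_filter]
  constructor
  · rintro ⟨z, ⟨hz, hz'⟩, rfl⟩
    exact ⟨(h.mem_complement_iff q z).1 hz, (hfix z).1 hz'⟩
  · rintro ⟨hv, hv'⟩
    refine ⟨(quotEquiv h q).symm v, ⟨(h.mem_complement_iff q _).2 ?_, (hfix _).2 ?_⟩, by simp⟩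
    · simpa using hv
    · simpa using hv'

end chi

end TypeB
end CoxeterCharacter

theorem mainTheorem6 {ι E N : Type*} [Finite ι] [NormedAddCommGroup E] [InnerProductSpace ℝ E]
    [AddCommGroup N] [Module ℝ N] (P : RootPairing ι ℝ E N)
    [P.IsRootSystem] [P.IsCrystallographic] [P.IsReduced] [CoxeterCharacter.IsEuclidean P]
    (ℓ : ℕ) (hℓ : 2 ≤ ℓ) (b : P.Base) (e : Fin ℓ ≃ b.support)
    (hB : ∀ i j, b.cartanMatrix (e i) (e j) = CartanMatrix.B ℓ i j) :
    CoxeterCharacter.alcoveStabilizer b = {1, CoxeterCharacter.omega b (e ⟨0, by omega⟩)} ∧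
    ∀ q : ℕ, 0 < q →
      (Odd q → (CoxeterCharacter.chi P q 1 : ℤ) =
        ∏ i ∈ Finset.Icc 1 ℓ, ((q : ℤ) - (2 * (i : ℤ) - 1))) ∧
      (Even q → (CoxeterCharacter.chi P q 1 : ℤ) =
        (∏ i ∈ Finset.Icc 1 (ℓ - 1), ((q : ℤ) - 2 * (i : ℤ))) * ((q : ℤ) - (ℓ : ℤ))) ∧
      (Odd q → (CoxeterCharacter.chi P q (CoxeterCharacter.omega b (e ⟨0, by omega⟩)) : ℤ) = 0) ∧
      (Even q → (CoxeterCharacter.chi P q (CoxeterCharacter.omega b (e ⟨0, by omega⟩)) : ℤ) =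
        ∏ i ∈ Finset.Icc 1 (ℓ - 1), ((q : ℤ) - 2 * (i : ℤ))) := by

  obtain ⟨n, rfl⟩ : ∃ n, ℓ = n + 1 := ⟨ℓ - 1, by omega⟩
  have h : CoxeterCharacter.TypeB.IsTypeB e := hB
  have h0 : (⟨0, by omega⟩ : Fin (n + 1)) = 0 := rfl
  rw [h0]
  -- Rank at least 2 is what makes the index 1 available.
  refine ⟨h.alcoveStabilizer_eq (o := ⟨1, by omega⟩) rfl, fun q hq => ?_⟩
  have : NeZero q := ⟨hq.ne'⟩
  rw [h.chi_one, h.chi_omega]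
  exact ⟨fun hodd => CoxeterCharacter.TypeB.card_regular_of_odd hodd _,
    fun heven => CoxeterCharacter.TypeB.card_regular_of_even heven n,
    fun hodd => by rw [CoxeterCharacter.TypeB.regular_filter_of_odd hodd]; rfl,
    fun heven => CoxeterCharacter.TypeB.card_regular_filter_of_even heven n⟩
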